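/- Let $T$ be a first-order theory, in a language of any size, all of whose models are infinite (e.g. a complete theory with infinite models). For a model $O \models T$ let $\mathbb{O} \succeq O$ denote an ambient $|O|^+$-saturated ("monster") model. Tuples $d$ and tuples of variables $x,y$ are finite, and a global type is a complete type over $\mathbb{O}$. **Definitions.** (a) $T$ has ATP if there are a formula $\varphi(x,y)$ and a tree $(b_\sigma)_{\sigma\in 2^{<\omega}}$ in a model of $T$ such that $\{\varphi(x,b_\sigma):\sigma\in X\}$ is consistent for every antichain $X\subseteq 2^{<\omega}$, and $\{\varphi(x,b_\sigma),\varphi(x,b_\tau)\}$ is inconsistent whenever $\sigma$ is a proper initial segment of $\tau$. $T$ is NATP if it does not have ATP. (b) A global type $q(y)$ is $A$-invariant if, for every $A$-formula $\varphi(y,z)$, whether $\varphi(y,b)\in q$ depends only on $\mathrm{tp}(b/A)$. For $A\subseteq C$, write $d \perp^{i}_A C$ if $\mathrm{tp}(d/C)$ extends to a global $A$-invariant type. A Morley sequence over $A$ generated by $q$ is a sequence $(e_i)_{i<\omega}$ with $e_i\models q\restriction A e_{<i}$ for all $i$; similarly $(e_0,\dots,e_{r-1})\models q^{\otimes r}\restriction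 C$ means that $e_i\models q\restriction C e_{<i}$ for all $i<r$. The formula $\varphi(x,y)$ $q$-Kim-divides (over $A$) if $\{\varphi(x,e_i):i<\omega\}$ is inconsistent for a Morley sequence $(e_i)_{i<\omega}$ over $A$ generated by $q$, and $\varphi(x,d)$ Kim-divides over $A$ if $\varphi(x,y)$ $q$-Kim-divides for some global $A$-invariant $q\supseteq\mathrm{tp}(d/A)$. (c) A global type $p(y)$ is strongly $A$-bi-invariant if it is $A$-invariant and, for every $r<\omega$, whenever $a\models p^{\otimes r}\restriction Ab$, the type $\mathrm{tp}(b/Aa)$ extends to a global $A$-invariant type. (d) For models $M\preceq N \preceq O$ and $p\in S(O)$, $\Xi(p,M,N)$ is the condition: for every $M$-formula $\varphi(x,y)$ and every tuple $d$ of $O$ with $\varphi(x,d)\in p$ and $d\perp^{i}_M N$, the formula $\varphi(x,d)$ does not Kim-divide over $N$. (e) For a set $O$ and a cardinal $\kappa$ let $[O]^\kappa=\{X\subseteq O:|X|=\kappa\}$. A club in $[O]^\kappa$ is a subset that is cofinal under $\subseteq$ and closed under unions of nonempty chains of at most $\kappa$ members. A set is stationary in $[O]^\kappa$ if it meets every club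 in $[O]^\kappa$. (f) $T$ satisfies generic stationary local character if for every cardinal $\lambda$ there is a cardinal $\kappa$ such that for every $\kappa^+$-saturated model $O\models T$, every type $p(x)\in S(O)$ in finitely many variables, and every $M\preceq O$ with $|M|\le\lambda$, the set $$\{N\preceq O : M\preceq N,\ |N|\le\kappa,\ \Xi(p,M,N)\}$$ is stationary in $[O]^\kappa$. **Theorem.** (1) If $T$ is NATP, then $T$ satisfies generic stationary local character. (2) If $T$ does not satisfy generic stationary local character, then there are a model $N\models T$, elementary in an $|N|^+$-saturated ambient model, a formula $\varphi(x,y)$, a tuple $d$ of the ambient model, a strongly $N$-bi-invariant global type $p(y)\supseteq\mathrm{tp}(d/N)$ and an $N$-invariant global type $q(y)\supseteq\mathrm{tp}(d/N)$ such that $\varphi(x,y)$ $q$-Kim-divides but does not $p$-Kim-divide (both over $N$). -/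

import Mathlib

universe u v w

open FirstOrder

namespace LocalCharacter

section Types

variable {L : FirstOrder.Language.{u, v}} {𝕆 : Type w} [L.Structure 𝕆]

/-- `S_n(A)`: complete `n`-types over the parameter set `A ⊆ 𝕆`, for the theory of `𝕆` with constants
for the elements of `A`. -/
abbrev TypeOver (L : FirstOrder.Language.{u, v}) {𝕆 : Type w} [L.Structure 𝕆] (A : Set 𝕆) (n : ℕ) :=
  (L[[A]].completeTheory 𝕆).CompleteType (Fin n)

/-- Global types: complete types over the whole ambient model. -/
abbrev GlobalType (L : FirstOrder.Language.{u, v}) (𝕆 : Type w) [L.Structure 𝕆] (n : ℕ) :=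
  TypeOver L (Set.univ : Set 𝕆) n

/-- `tp(a/A)`. -/
def tp [Nonempty 𝕆] (A : Set 𝕆) {n : ℕ} (a : Fin n → 𝕆) : TypeOver L A n :=
  (L[[A]].completeTheory 𝕆).typeOf a

/-- The `A`-formula `φ(x)` belongs to the type `p` over `A`. -/
def TypeOver.Has {A : Set 𝕆} {n : ℕ} (p : TypeOver L A n) (φ : L[[A]].Formula (Fin n)) : Prop :=
  FirstOrder.Language.Formula.equivSentence φ ∈ p

/-- An `A`-formula seen as a `B`-formula, where `A ⊆ B`. -/
def lift {A B : Set 𝕆} (h : A ⊆ B) {α : Type*} (φ : L[[A]].Formula α) : L[[B]].Formula α :=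
  (L.lhomWithConstantsMap (Set.inclusion h)).onFormula φ

/-- The `A`-formula `φ(x, b)` obtained from an `A`-formula `φ(x, y)` and a tuple `b` from `A`. -/
def plug {A : Set 𝕆} {α β : Type*} (φ : L[[A]].Formula (α ⊕ β)) (b : β → A) : L[[A]].Formula α :=
  FirstOrder.Language.BoundedFormula.subst φ
    (Sum.elim FirstOrder.Language.Term.var fun j => (L.con (b j)).term)

theorem realize_lift {A B : Set 𝕆} (h : A ⊆ B) {α : Type*} (φ : L[[A]].Formula α) (a : α → 𝕆) :
    (lift h φ).Realize a ↔ φ.Realize a :=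
  FirstOrder.Language.LHom.realize_onFormula _ φ

theorem realize_plug {A : Set 𝕆} {α β : Type*} (φ : L[[A]].Formula (α ⊕ β)) (b : β → A)
    (a : α → 𝕆) : (plug φ b).Realize a ↔ φ.Realize (Sum.elim a fun j => (b j : 𝕆)) := by
  unfold plug FirstOrder.Language.Formula.Realize
  rw [FirstOrder.Language.BoundedFormula.realize_subst]
  have : (fun i => FirstOrder.Language.Term.realize a ((Sum.elim FirstOrder.Language.Term.var fun j => (L.con (b j)).term :
      α ⊕ β → L[[A]].Term α) i)) = Sum.elim a fun j => (b j : 𝕆) := by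
    funext i
    cases i <;> simp
  rw [this]

/-- `κ`-saturation: every complete type in finitely many variables over fewer than `κ` parameters
is realized. -/
def IsSaturated (L : FirstOrder.Language.{u, v}) (κ : Cardinal.{w}) (K : Type w) [L.Structure K]
    [Nonempty K] : Prop :=
  ∀ A : Set K, Cardinal.mk A < κ → ∀ (n : ℕ) (p : TypeOver L A n), ∃ a : Fin n → K, tp A a = p

/-- `a ⊨ q ↾ C` for a global type `q`, i.e. `q` extends `tp(a/C)`. -/
def RealizesRestriction {m : ℕ} (q : GlobalType L 𝕆 m) (C : Set 𝕆) (a : Fin m → 𝕆) : Prop :=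
  ∀ ψ : L[[C]].Formula (Fin m), q.Has (lift (Set.subset_univ C) ψ) ↔ ψ.Realize a

/-- The global type `q` is `A`-invariant: whether `φ(x, b) ∈ q`, for an `A`-formula `φ(x, y)`,
depends only on `tp(b/A)`. -/
def IsInvariant [Nonempty 𝕆] {m : ℕ} (q : GlobalType L 𝕆 m) (A : Set 𝕆) : Prop :=
  ∀ (k : ℕ) (φ : L[[A]].Formula (Fin m ⊕ Fin k)) (b b' : Fin k → 𝕆),
    (tp A b : TypeOver L A k) = tp A b' →
      (q.Has (plug (lift (Set.subset_univ A) φ) fun j => ⟨b j, trivial⟩) ↔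
        q.Has (plug (lift (Set.subset_univ A) φ) fun j => ⟨b' j, trivial⟩))

/-- `tp(d/C)` extends to a global `A`-invariant type. For `A ⊆ C` this is the relation
`d ⫝ⁱ_A C` of invariant independence. -/
def InvariantlyIndep (L : FirstOrder.Language.{u, v}) {𝕆 : Type w} [L.Structure 𝕆] [Nonempty 𝕆]
    (A C : Set 𝕆) {m : ℕ} (d : Fin m → 𝕆) : Prop :=
  ∃ q : GlobalType L 𝕆 m, IsInvariant q A ∧ RealizesRestriction q C d

/-- The set of formulas `{φ(x, b i) : i ∈ X}` is (finitely) consistent. -/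
def ConsistentOn {L' : FirstOrder.Language} [L'.Structure 𝕆] {n m : ℕ} (φ : L'.Formula (Fin n ⊕ Fin m))
    {ι : Type*} (b : ι → Fin m → 𝕆) (X : Set ι) : Prop :=
  ∀ s : Finset ι, (s : Set ι) ⊆ X → ∃ x : Fin n → 𝕆, ∀ i ∈ s, φ.Realize (Sum.elim x (b i))

/-- `(e i)_{i < ω}` is a Morley sequence over `A` generated by `q`: `e i ⊨ q ↾ A e_{<i}`. -/
def IsMorleySequence {m : ℕ} (q : GlobalType L 𝕆 m) (A : Set 𝕆) (e : ℕ → Fin m → 𝕆) : Prop :=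
  ∀ i, RealizesRestriction q (A ∪ ⋃ j, ⋃ (_ : j < i), Set.range (e j)) (e i)

/-- `φ(x, y)` `q`-Kim-divides (over `A`): it divides along a Morley sequence over `A` generated by
`q`. -/
def KimDividesAlong {n m : ℕ} (A : Set 𝕆) (φ : L[[A]].Formula (Fin n ⊕ Fin m))
    (q : GlobalType L 𝕆 m) : Prop :=
  ∃ e : ℕ → Fin m → 𝕆, IsMorleySequence q A e ∧ ¬ ConsistentOn φ e Set.univ

/-- `φ(x, d)` Kim-divides over `A`: `φ(x, y)` `q`-Kim-divides for some global `A`-invariant type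
`q ⊇ tp(d/A)`. -/
def KimDivides [Nonempty 𝕆] {n m : ℕ} (A : Set 𝕆) (φ : L[[A]].Formula (Fin n ⊕ Fin m))
    (d : Fin m → 𝕆) : Prop :=
  ∃ q : GlobalType L 𝕆 m, IsInvariant q A ∧ RealizesRestriction q A d ∧ KimDividesAlong A φ q

/-- `a = (a 0, …, a (r - 1))` realizes `p^{⊗ r} ↾ C`: `a i ⊨ p ↾ C a_{<i}` for every `i < r`. -/
def RealizesPower {m : ℕ} (p : GlobalType L 𝕆 m) (C : Set 𝕆) {r : ℕ} (a : Fin r → Fin m → 𝕆) :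
    Prop :=
  ∀ i, RealizesRestriction p (C ∪ ⋃ j, ⋃ (_ : j < i), Set.range (a j)) (a i)

/-- `p` is strongly `A`-bi-invariant: `p` is `A`-invariant and for every `r`, whenever
`a ⊨ p^{⊗ r} ↾ A b`, the type `tp(b/Aa)` extends to a global `A`-invariant type. -/
def IsStronglyBiInvariant [Nonempty 𝕆] {m : ℕ} (p : GlobalType L 𝕆 m) (A : Set 𝕆) : Prop :=
  IsInvariant p A ∧
    ∀ (r k : ℕ) (a : Fin r → Fin m → 𝕆) (b : Fin k → 𝕆),
      RealizesPower p (A ∪ Set.range b) a →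
        InvariantlyIndep L A (A ∪ ⋃ i, Set.range (a i)) b

/-- The condition `Ξ(p, M, N)`, for `p` a type over `O` and `M ⊆ N`, `M ⊆ O`: for every `M`-formula
`φ(x, y)` and every `d` with `φ(x, d) ∈ p` and `d ⫝ⁱ_M N`, `φ(x, d)` does not Kim-divide
over `N`. -/
def Xi [Nonempty 𝕆] {O M N : Set 𝕆} (hMO : M ⊆ O) (hMN : M ⊆ N) {n : ℕ} (p : TypeOver L O n) :
    Prop :=
  ∀ (m : ℕ) (φ : L[[M]].Formula (Fin n ⊕ Fin m)) (d : Fin m → O),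
    p.Has (plug (lift hMO φ) d) →
      InvariantlyIndep L M N (fun j => (d j : 𝕆)) →
        ¬ KimDivides N (lift hMN φ) (fun j => (d j : 𝕆))

end Types

section Clubs

variable {S : Type w}

/-- `[O]^κ`, the set of subsets of `O` of cardinality `κ`. -/
def subsetsOfCard (O : Set S) (κ : Cardinal.{w}) : Set (Set S) :=
  {X | X ⊆ O ∧ Cardinal.mk X = κ}

/-- `C` is a club in `[O]^κ`: it is unbounded, and closed under unions of nonempty chains of at most
`κ` members. -/
def IsClubIn (O : Set S) (κ : Cardinal.{w}) (C : Set (Set S)) : Prop :=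
  C ⊆ subsetsOfCard O κ ∧
  (∀ Y ∈ subsetsOfCard O κ, ∃ X ∈ C, Y ⊆ X) ∧
  ∀ D : Set (Set S), D ⊆ C → D.Nonempty → IsChain (· ⊆ ·) D → Cardinal.mk D ≤ κ → ⋃₀ D ∈ C

/-- `E` is stationary in `[O]^κ`: it meets every club. -/
def IsStationaryIn (O : Set S) (κ : Cardinal.{w}) (E : Set (Set S)) : Prop :=
  ∀ C, IsClubIn O κ C → (E ∩ C).Nonempty

end Clubs

section Theories

variable {L : FirstOrder.Language.{u, v}}

/-- `T` has the antichain tree property: some formula `φ(x, y)` and some tree `(b_σ)_{σ ∈ 2^{<ω}}`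
in a model of `T` are such that `{φ(x, b_σ) : σ ∈ X}` is consistent for each antichain `X`, while
`φ(x, b_σ)` and `φ(x, b_τ)` are inconsistent whenever `σ` is a proper initial segment of `τ`. -/
def HasATP (T : L.Theory) : Prop :=
  ∃ (K : FirstOrder.Language.Theory.ModelType.{u, v, w} T) (n m : ℕ) (φ : L.Formula (Fin n ⊕ Fin m))
    (b : List Bool → Fin m → K),
    (∀ X : Set (List Bool), IsAntichain (fun σ τ => σ <+: τ) X → ConsistentOn φ b X) ∧
    ∀ σ τ : List Bool, σ <+: τ → σ ≠ τ →
      ¬ ∃ x : Fin n → K, φ.Realize (Sum.elim x (b σ)) ∧ φ.Realize (Sum.elim x (b τ))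

/-- `T` is NATP. -/
def IsNATP (T : L.Theory) : Prop := ¬ HasATP.{u, v, w} T

/-- Generic stationary local character. The ambient model `𝕆` plays the role of the monster model:
`O` is small in it, in the sense that `𝕆` is `|O|⁺`-saturated. -/
def GenericStationaryLocalCharacter (T : L.Theory) : Prop :=
  ∀ lam : Cardinal.{w}, ∃ κ : Cardinal.{w},
    ∀ (𝕆 : FirstOrder.Language.Theory.ModelType.{u, v, w} T) (O : L.ElementarySubstructure 𝕆),
      IsSaturated L (Order.succ (Cardinal.mk O)) 𝕆 →
      IsSaturated L (Order.succ κ) O →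
      ∀ (n : ℕ) (p : TypeOver L (O : Set 𝕆) n) (M : L.ElementarySubstructure 𝕆)
        (hMO : (M : Set 𝕆) ⊆ O), Cardinal.mk M ≤ lam →
        IsStationaryIn (O : Set 𝕆) κ
          {X | ∃ (N : L.ElementarySubstructure 𝕆) (hMN : (M : Set 𝕆) ⊆ N),
            (N : Set 𝕆) = X ∧ (N : Set 𝕆) ⊆ O ∧ Cardinal.mk N ≤ κ ∧ Xi hMO hMN p}

/-- `T` fails Kim's lemma for strongly bi-invariant types: there are a small model `N`, a formula
`φ(x, d)`, a strongly `N`-bi-invariant type `p ⊇ tp(d/N)` and an `N`-invariant type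
`q ⊇ tp(d/N)` such that `φ(x, y)` `q`-Kim-divides but does not `p`-Kim-divide. -/
def StrongBiInvariantKimFailure (T : L.Theory) : Prop :=
  ∃ (𝕆 : FirstOrder.Language.Theory.ModelType.{u, v, w} T) (N : L.ElementarySubstructure 𝕆),
    IsSaturated L (Order.succ (Cardinal.mk N)) 𝕆 ∧
    ∃ (n m : ℕ) (φ : L.Formula (Fin n ⊕ Fin m)) (d : Fin m → 𝕆) (p q : GlobalType L 𝕆 m),
      IsStronglyBiInvariant p (N : Set 𝕆) ∧ RealizesRestriction p (N : Set 𝕆) d ∧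
      IsInvariant q (N : Set 𝕆) ∧ RealizesRestriction q (N : Set 𝕆) d ∧
      KimDividesAlong (N : Set 𝕆) ((L.lhomWithConstants (N : Set 𝕆)).onFormula φ) q ∧
      ¬ KimDividesAlong (N : Set 𝕆) ((L.lhomWithConstants (N : Set 𝕆)).onFormula φ) p

end Theories

end LocalCharacter

/-!
A complete type over any set is the trace of an ultrafilter on tuples of the ambient model: its
formulas are those that hold almost everywhere. Invariance, Morley sequences and invariant
extensions are therefore properties of ultrafilters.

Suppose that a strongly `N`-bi-invariant `p` and an `N`-invariant `q`, both extending `tp(d/N)`,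
disagree on whether `φ` Kim-divides. Strong bi-invariance lets one add a common root below two
copies of a tree without disturbing the Morley sequences already present. This gives binary trees of
every finite height whose antichains are Morley sequences of `p`, hence consistent with `φ`, and
whose chains are Morley sequences of `q`, hence `k`-inconsistent with `φ` for a fixed `k`. Replacing
`k` by a power of two, one halves it repeatedly: if each node of the tree can be given a second
parameter, then `φ(x, y) ∧ φ(x, y')` has such a tree with `k / 2` in place of `k`. This must fail
before `k = 1`, where a single instance would be both consistent and inconsistent. Say that it fails
at a node `η`. Then to each pair `u < u'` above `η` there is an antichain `P` of parameters
incomparable with `η`, one of finitely many, such that the instances of `φ` at `u`, `u'` and `P` are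
jointly inconsistent. By a Ramsey argument `P` is constant on the comparable pairs of a subtree, and
on that subtree `φ(x, y)`, in conjunction with the instances at `P`, witnesses ATP.

For the failure of local character, let `M`, `p` and a club witness it, for `κ = 2 ^ 2 ^ μ` with `μ`
bounding `M` and the language. There are at most `κ` types over the ambient model that are
`M`-invariant, since such a type is determined by a set of pairs of a formula over `M` and a type
over `M`. For each of them, and each `φ`, adjoin to `M` a longest Morley sequence among the
parameters of the instances of `φ` in `p`, if there is a longest one. Some `N` in the club contains
all these and realizes all types over `M` and finite tuples of `N`. The latter makes every
`M`-invariant type strongly `N`-bi-invariant. As `Ξ(p, M, N)` fails, some `φ(x, d) ∈ p` Kim-divides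
over `N`, where `d` realizes over `N` the restriction of an `M`-invariant type `r`. So no longest
Morley sequence was adjoined for `r`: arbitrarily long ones have their instances of `φ` in `p`, and
`φ(x, y)` does not `r`-Kim-divide.
-/

namespace LocalCharacter

open Language

section Definability

variable {L : FirstOrder.Language.{u, v}} {𝕆 : Type w} [L.Structure 𝕆]

/-- Two tuples have the same type over `A`: they lie in the same `A`-definable sets. -/
def SameType (L : FirstOrder.Language.{u, v}) {𝕆 : Type w} [L.Structure 𝕆] (A : Set 𝕆) {ι : Type*}
    (a b : ι → 𝕆) : Prop :=
  ∀ S : Set (ι → 𝕆), A.Definable L S → (a ∈ S ↔ b ∈ S)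

/-- The type of an ultrafilter `U` on tuples consists of the definable sets that belong to `U`;
every complete type arises in this way (`TypeOver.exists_represents`). The tuple `a` realizes the
restriction of this type to `C`. -/
def RealizesOver (L : FirstOrder.Language.{u, v}) {𝕆 : Type w} [L.Structure 𝕆] {ι : Type*}
    (U : Ultrafilter (ι → 𝕆)) (C : Set 𝕆) (a : ι → 𝕆) : Prop :=
  ∀ S : Set (ι → 𝕆), C.Definable L S → (S ∈ U ↔ a ∈ S)

/-- The type of an ultrafilter on tuples is `A`-invariant. -/
def InvariantOver (L : FirstOrder.Language.{u, v}) {𝕆 : Type w} [L.Structure 𝕆] {ι : Type*}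
    (U : Ultrafilter (ι → 𝕆)) (A : Set 𝕆) : Prop :=
  ∀ (k : ℕ) (S : Set (ι ⊕ Fin k → 𝕆)), A.Definable L S → ∀ b b' : Fin k → 𝕆, SameType L A b b' →
    ({x | Sum.elim x b ∈ S} ∈ U ↔ {x | Sum.elim x b' ∈ S} ∈ U)

variable {A B C : Set 𝕆} {ι ι' γ : Type*}

theorem definable_fiber {S : Set (ι ⊕ γ → 𝕆)} (hS : A.Definable L S) (hA : A ⊆ C) {b : γ → 𝕆}
    (hb : Set.range b ⊆ C) : C.Definable L {x | Sum.elim x b ∈ S} := by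
  obtain ⟨φ, rfl⟩ := hS
  refine ⟨plug (lift hA φ) fun j => ⟨b j, hb ⟨j, rfl⟩⟩, Set.ext fun x => ?_⟩
  change φ.Realize (Sum.elim x b) ↔ (plug (lift hA φ) _).Realize x
  rw [realize_plug, realize_lift]

theorem exists_definable_eq_fiber {b : γ → 𝕆} {S : Set (ι → 𝕆)}
    (hS : (A ∪ Set.range b).Definable L S) :
    ∃ S' : Set (ι ⊕ γ → 𝕆), A.Definable L S' ∧ S = {x | Sum.elim x b ∈ S'} := by
  obtain ⟨φ, rfl⟩ := Set.definable_iff_exists_formula_sum.1 hS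
  have hparam : ∀ c : (A ∪ Set.range b : Set 𝕆), ∃ t : A ⊕ γ, Sum.elim (↑) b t = (c : 𝕆) := by
    rintro ⟨c, hc | ⟨j, rfl⟩⟩
    · exact ⟨Sum.inl ⟨c, hc⟩, rfl⟩
    · exact ⟨Sum.inr j, rfl⟩
  choose t ht using hparam
  let f : (A ∪ Set.range b : Set 𝕆) ⊕ ι → A ⊕ (ι ⊕ γ) :=
    Sum.elim (fun c => Sum.map id Sum.inr (t c)) (fun i => Sum.inr (Sum.inl i))
  refine ⟨_, Set.definable_iff_exists_formula_sum.2 ⟨φ.relabel f, rfl⟩, Set.ext fun x => ?_⟩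
  have hf : (Sum.elim (↑) (Sum.elim x b) : A ⊕ (ι ⊕ γ) → 𝕆) ∘ f = Sum.elim (↑) x := by
    ext (c | i)
    · rw [Sum.elim_inl, ← ht c]
      rcases h : t c with a | j <;> simp [f, h]
    · rfl
  change φ.Realize _ ↔ (φ.relabel f).Realize _
  rw [Formula.realize_relabel, hf]

theorem exists_empty_definable_eq_fiber {S : Set (ι → 𝕆)} (hS : A.Definable L S) :
    ∃ (k : ℕ) (c : Fin k → 𝕆) (S' : Set (ι ⊕ Fin k → 𝕆)), Set.range c ⊆ A ∧
      (∅ : Set 𝕆).Definable L S' ∧ S = {x | Sum.elim x c ∈ S'} := by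
  obtain ⟨B, hB, hS⟩ := Set.definable_iff_finitely_definable.1 hS
  have hrange : Set.range (fun i => (B.equivFin.symm i : 𝕆)) = B := by
    rw [← Function.comp_def, B.equivFin.symm.surjective.range_comp, Subtype.range_coe]
  rw [← Set.empty_union (B : Set 𝕆), ← hrange] at hS
  obtain ⟨S', hS', h⟩ := exists_definable_eq_fiber hS
  exact ⟨B.card, _, S', hrange ▸ hB, hS', h⟩

namespace SameType

theorem refl (a : ι → 𝕆) : SameType L A a a := fun _ _ => Iff.rfl

theorem symm {a b : ι → 𝕆} (h : SameType L A a b) : SameType L A b a := fun S hS => (h S hS).symm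

theorem trans {a b c : ι → 𝕆} (h : SameType L A a b) (h' : SameType L A b c) : SameType L A a c :=
  fun S hS => (h S hS).trans (h' S hS)

theorem mono {a b : ι → 𝕆} (h : SameType L B a b) (hAB : A ⊆ B) : SameType L A a b :=
  fun S hS => h S (hS.mono hAB)

theorem comp {a b : ι → 𝕆} (h : SameType L A a b) (f : ι' → ι) : SameType L A (a ∘ f) (b ∘ f) :=
  fun _ hS => h _ (hS.preimage_comp f)

theorem adjoin {b : γ → 𝕆} {a a' : ι → 𝕆} (h : SameType L (A ∪ Set.range b) a a') :
    SameType L A (Sum.elim a b) (Sum.elim a' b) :=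
  fun _ hS => h _ (definable_fiber hS Set.subset_union_left Set.subset_union_right)

end SameType

section Ultrafilter

variable {U : Ultrafilter (ι → 𝕆)} {a b : ι → 𝕆}

theorem RealizesOver.mono (h : RealizesOver L U C a) (hBC : B ⊆ C) : RealizesOver L U B a :=
  fun S hS => h S (hS.mono hBC)

theorem RealizesOver.sameType (h : RealizesOver L U C a) (h' : RealizesOver L U C b) :
    SameType L C a b :=
  fun S hS => (h S hS).symm.trans (h' S hS)

theorem RealizesOver.of_sameType (h : RealizesOver L U C a) (h' : SameType L C a b) :
    RealizesOver L U C b :=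
  fun S hS => (h S hS).trans (h' S hS)

theorem InvariantOver.mem_iff [Finite γ] (hU : InvariantOver L U A) {S : Set (ι ⊕ γ → 𝕆)}
    (hS : A.Definable L S) {c c' : γ → 𝕆} (hc : SameType L A c c') :
    {x | Sum.elim x c ∈ S} ∈ U ↔ {x | Sum.elim x c' ∈ S} ∈ U := by
  obtain ⟨k, ⟨e⟩⟩ := Finite.exists_equiv_fin γ
  have h := hU k _ (hS.preimage_comp (Sum.map id e)) (c ∘ e.symm) (c' ∘ e.symm) (hc.comp _)
  simpa only [Set.mem_preimage, Set.mem_ofPred_eq, Sum.elim_comp_map, Function.comp_id,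
    Function.comp_assoc, e.symm_comp_self] using h

theorem InvariantOver.mono (h : InvariantOver L U A) (hAB : A ⊆ B) : InvariantOver L U B := by
  intro k S hS b b' hb
  obtain ⟨l, c, S', hc, hS', rfl⟩ := exists_empty_definable_eq_fiber hS
  have hbc : SameType L A (Sum.elim b c) (Sum.elim b' c) :=
    (hb.mono (Set.union_subset hAB hc)).adjoin
  have key := h.mem_iff
    ((hS'.preimage_comp (Equiv.sumAssoc _ _ _)).mono (Set.empty_subset A)) hbc
  have hassoc : ∀ (b : Fin k → 𝕆) (x : ι → 𝕆),
      Sum.elim x (Sum.elim b c) ∘ Equiv.sumAssoc _ _ _ = Sum.elim (Sum.elim x b) c := by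
    intro b x
    ext ((i | i) | i) <;> rfl
  simpa only [Set.mem_preimage, Set.mem_ofPred_eq, hassoc] using key

variable [Finite γ] {c c' : γ → 𝕆}

theorem InvariantOver.sameType_elim (hU : InvariantOver L U A)
    (ha : RealizesOver L U (A ∪ Set.range c) a) (hb : RealizesOver L U (A ∪ Set.range c') b)
    (hc : SameType L A c c') : SameType L A (Sum.elim a c) (Sum.elim b c') := by
  intro S hS
  have h1 := ha _ (definable_fiber hS Set.subset_union_left Set.subset_union_right)
  have h2 := hb _ (definable_fiber hS Set.subset_union_left Set.subset_union_right)
  exact h1.symm.trans ((hU.mem_iff hS hc).trans h2)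

theorem InvariantOver.realizesOver_congr (hU : InvariantOver L U A)
    (ha : RealizesOver L U (A ∪ Set.range c) a)
    (h : SameType L A (Sum.elim a c) (Sum.elim b c')) :
    RealizesOver L U (A ∪ Set.range c') b := by
  intro S hS
  obtain ⟨S', hS', rfl⟩ := exists_definable_eq_fiber hS
  have hc : SameType L A c c' := by simpa only [Sum.elim_comp_inr] using h.comp Sum.inr
  have h1 := ha _ (definable_fiber hS' Set.subset_union_left Set.subset_union_right)
  exact (hU.mem_iff hS' hc).symm.trans (h1.trans (h S' hS'))

end Ultrafilter

end Definability

section Representation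

variable {L : FirstOrder.Language.{u, v}} {𝕆 : Type w} [L.Structure 𝕆] {A C : Set 𝕆} {n m : ℕ}

theorem exists_ultrafilter_realize_mem_iff {α ι : Type*} (f : α → ι → 𝕆) (P : L.Formula ι → Prop)
    (h_not : ∀ ψ, P ψ.not ↔ ¬ P ψ) (h_inf : ∀ ψ χ, P ψ → P χ → P (ψ ⊓ χ))
    (h_exists : ∀ ψ, P ψ → ∃ x, ψ.Realize (f x)) :
    ∃ W : Ultrafilter α, ∀ ψ, {x | ψ.Realize (f x)} ∈ W ↔ P ψ := by
  let F : FilterBasis α :=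
    { sets := {S | ∃ ψ, P ψ ∧ {x | ψ.Realize (f x)} = S}
      nonempty := by
        by_cases h : P ⊤
        · exact ⟨_, ⊤, h, rfl⟩
        · exact ⟨_, _, (h_not ⊤).2 h, rfl⟩
      inter_sets := by
        rintro _ _ ⟨ψ, hψ, rfl⟩ ⟨χ, hχ, rfl⟩
        exact ⟨_, ⟨ψ ⊓ χ, h_inf ψ χ hψ hχ, rfl⟩, fun x hx => Formula.realize_inf.1 hx⟩ }
  have hF : F.filter.NeBot := by
    refine Filter.neBot_iff.2 (mt Filter.empty_mem_iff_bot.2 fun h => ?_)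
    obtain ⟨_, ⟨ψ, hψ, rfl⟩, hempty⟩ := F.mem_filter_iff.1 h
    obtain ⟨x, hx⟩ := h_exists ψ hψ
    exact hempty hx
  have hmem : ∀ ψ, P ψ → {x | ψ.Realize (f x)} ∈ Ultrafilter.of F.filter := fun ψ hψ =>
    Ultrafilter.of_le _ (F.mem_filter_of_mem ⟨ψ, hψ, rfl⟩)
  refine ⟨Ultrafilter.of F.filter, fun ψ => ⟨fun h => ?_, hmem ψ⟩⟩
  by_contra hn
  exact Ultrafilter.compl_mem_iff_notMem.1 (hmem _ ((h_not ψ).2 hn)) h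

/-- The type `q` over `A` consists of the formulas that hold `U`-almost everywhere. -/
def Represents (U : Ultrafilter (Fin n → 𝕆)) (q : TypeOver L A n) : Prop :=
  ∀ ψ : L[[A]].Formula (Fin n), q.Has ψ ↔ {x | ψ.Realize x} ∈ U

theorem TypeOver.has_not (q : TypeOver L A n) (ψ : L[[A]].Formula (Fin n)) :
    q.Has ψ.not ↔ ¬ q.Has ψ :=
  q.not_mem_iff (Formula.equivSentence ψ)

theorem TypeOver.has_inf (q : TypeOver L A n) {ψ χ : L[[A]].Formula (Fin n)}
    (h : q.Has ψ) (h' : q.Has χ) : q.Has (ψ ⊓ χ) := by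
  unfold TypeOver.Has at *
  rw [← SetLike.mem_coe, q.isMaximal.mem_iff_models, Theory.models_sentence_iff] at *
  exact fun K => BoundedFormula.realize_inf.2 ⟨h K, h' K⟩

theorem TypeOver.ext_has {p q : TypeOver L A n} (h : ∀ ψ, p.Has ψ ↔ q.Has ψ) : p = q := by
  refine SetLike.ext fun σ => ?_
  obtain ⟨ψ, rfl⟩ := (Formula.equivSentence (L := L[[A]])).surjective σ
  exact h ψ

theorem realize_iAlls_relabel_inr {α : Type*} [Finite α] (ψ : L.Formula α) :
    𝕆 ⊨ (ψ.relabel Sum.inr : L.Formula (Empty ⊕ α)).iAlls α ↔ ∀ x : α → 𝕆, ψ.Realize x := by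
  simp only [Sentence.Realize, Formula.realize_iAlls, Formula.realize_relabel, Sum.elim_comp_inr]

theorem TypeOver.has_of_forall (q : TypeOver L A n) {ψ : L[[A]].Formula (Fin n)}
    (h : ∀ x : Fin n → 𝕆, ψ.Realize x) : q.Has ψ := by
  refine q.mem_of_models ?_
  rw [← Theory.models_formula_iff_onTheory_models_equivSentence, Theory.models_formula_iff]
  intro K
  exact (realize_iAlls_relabel_inr ψ).1 (K.is_model.realize_of_mem _
    (mem_completeTheory.2 ((realize_iAlls_relabel_inr ψ).2 h)))

theorem TypeOver.exists_represents (q : TypeOver L A n) :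
    ∃ U : Ultrafilter (Fin n → 𝕆), Represents U q := by
  obtain ⟨U, hU⟩ := exists_ultrafilter_realize_mem_iff id q.Has q.has_not
    (fun _ _ => q.has_inf) fun ψ hψ => by
      by_contra! h
      exact (q.has_not ψ).1 (q.has_of_forall fun x => Formula.realize_not.2 (h x)) hψ
  exact ⟨U, fun ψ => (hU ψ).symm⟩

section Nonempty

variable [Nonempty 𝕆]

theorem has_tp_iff (a : Fin n → 𝕆) (ψ : L[[A]].Formula (Fin n)) :
    (tp A a : TypeOver L A n).Has ψ ↔ ψ.Realize a :=
  Theory.CompleteType.formula_mem_typeOf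

theorem tp_eq_iff {a b : Fin n → 𝕆} : (tp A a : TypeOver L A n) = tp A b ↔ SameType L A a b := by
  constructor
  · rintro h S ⟨ψ, rfl⟩
    change ψ.Realize a ↔ ψ.Realize b
    rw [← has_tp_iff, ← has_tp_iff, h]
  · intro h
    refine TypeOver.ext_has fun ψ => ?_
    rw [has_tp_iff, has_tp_iff]
    exact h _ ⟨ψ, rfl⟩

/-- The type over `A` whose formulas hold `U`-almost everywhere. -/
def ofUltrafilter (A : Set 𝕆) (U : Ultrafilter (Fin n → 𝕆)) : TypeOver L A n where
  toTheory := {σ | {x | σ ∈ (tp A x : TypeOver L A n)} ∈ U}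
  subset' σ hσ := Filter.univ_mem' fun x => (tp A x : TypeOver L A n).subset hσ
  isMaximal' := by
    constructor
    · rw [Theory.isSatisfiable_iff_isFinitelySatisfiable]
      intro T₀ hT₀
      obtain ⟨x, hx⟩ := Ultrafilter.nonempty_of_mem
        ((Filter.biInter_finset_mem T₀).2 fun σ hσ => hT₀ hσ)
      exact (tp A x : TypeOver L A n).isMaximal.1.mono fun σ hσ => Set.mem_iInter₂.1 hx σ hσ
    · intro σ
      exact Ultrafilter.union_mem_iff.1
        (Filter.univ_mem' fun x => (tp A x : TypeOver L A n).mem_or_not_mem σ)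

theorem represents_ofUltrafilter (A : Set 𝕆) (U : Ultrafilter (Fin n → 𝕆)) :
    Represents U (ofUltrafilter A U : TypeOver L A n) := by
  intro ψ
  simp only [← has_tp_iff]
  rfl

end Nonempty

section GlobalType

variable {U : Ultrafilter (Fin m → 𝕆)} {q : GlobalType L 𝕆 m}

theorem Represents.has_lift_iff (h : Represents U q) (ψ : L[[C]].Formula (Fin m)) :
    q.Has (lift (Set.subset_univ C) ψ) ↔ {x | ψ.Realize x} ∈ U := by
  simp only [h _, realize_lift]

theorem Represents.has_plug_iff (h : Represents U q) {k : ℕ} (φ : L[[C]].Formula (Fin m ⊕ Fin k))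
    (b : Fin k → 𝕆) :
    q.Has (plug (lift (Set.subset_univ C) φ) fun j => ⟨b j, trivial⟩) ↔
      {x | φ.Realize (Sum.elim x b)} ∈ U := by
  simp only [h _, realize_plug, realize_lift]

theorem Represents.realizesRestriction_iff (h : Represents U q) {a : Fin m → 𝕆} :
    RealizesRestriction q C a ↔ RealizesOver L U C a := by
  constructor
  · rintro hq S ⟨ψ, rfl⟩
    exact (h.has_lift_iff ψ).symm.trans (hq ψ)
  · intro hU ψ
    exact (h.has_lift_iff ψ).trans (hU _ ⟨ψ, rfl⟩)

variable [Nonempty 𝕆]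

theorem Represents.isInvariant_iff (h : Represents U q) :
    IsInvariant q A ↔ InvariantOver L U A := by
  constructor
  · rintro hq k S ⟨φ, rfl⟩ b b' hb
    exact (h.has_plug_iff φ b).symm.trans
      ((hq k φ b b' (tp_eq_iff.2 hb)).trans (h.has_plug_iff φ b'))
  · intro hU k φ b b' hb
    exact (h.has_plug_iff φ b).trans
      ((hU k _ ⟨φ, rfl⟩ b b' (tp_eq_iff.1 hb)).trans (h.has_plug_iff φ b').symm)

theorem invariantlyIndep_iff {d : Fin m → 𝕆} :
    InvariantlyIndep L A C d ↔
      ∃ U : Ultrafilter (Fin m → 𝕆), InvariantOver L U A ∧ RealizesOver L U C d := by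
  constructor
  · rintro ⟨q, hq, hd⟩
    obtain ⟨U, hU⟩ := q.exists_represents
    exact ⟨U, hU.isInvariant_iff.1 hq, hU.realizesRestriction_iff.1 hd⟩
  · rintro ⟨U, hU, hd⟩
    have h := represents_ofUltrafilter (L := L) Set.univ U
    exact ⟨_, h.isInvariant_iff.2 hU, h.realizesRestriction_iff.2 hd⟩

theorem IsSaturated.exists_realizesOver {κ : Cardinal.{w}} (h : IsSaturated L κ 𝕆)
    (U : Ultrafilter (Fin m → 𝕆)) (hC : Cardinal.mk C < κ) : ∃ a, RealizesOver L U C a := by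
  obtain ⟨a, ha⟩ := h C hC m (ofUltrafilter C U)
  refine ⟨a, ?_⟩
  rintro S ⟨ψ, rfl⟩
  exact (represents_ofUltrafilter C U ψ).symm.trans (ha ▸ has_tp_iff a ψ)

theorem IsSaturated.mono {κ μ : Cardinal.{w}} (h : IsSaturated L κ 𝕆) (hμ : μ ≤ κ) :
    IsSaturated L μ 𝕆 :=
  fun C hC k p => h C (hC.trans_le hμ) k p

end GlobalType

end Representation

section Morley

variable {L : FirstOrder.Language.{u, v}} {𝕆 : Type w} [L.Structure 𝕆] {A B C : Set 𝕆}
  {I J ι γ : Type*}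

/-- The family `e` is a Morley sequence over `C`, indexed by an order, in the type of `U`. -/
def MorleyOver [LT I] (L : FirstOrder.Language.{u, v}) {𝕆 : Type w} [L.Structure 𝕆] {ι : Type*}
    (U : Ultrafilter (ι → 𝕆)) (C : Set 𝕆) (e : I → ι → 𝕆) : Prop :=
  ∀ i, RealizesOver L U (C ∪ ⋃ j, ⋃ (_ : j < i), Set.range (e j)) (e i)

section Represents

variable {m : ℕ} {U : Ultrafilter (Fin m → 𝕆)} {q : GlobalType L 𝕆 m}

theorem Represents.isMorleySequence_iff (h : Represents U q) {e : ℕ → Fin m → 𝕆} :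
    IsMorleySequence q C e ↔ MorleyOver L U C e :=
  forall_congr' fun _ => h.realizesRestriction_iff

theorem Represents.realizesPower_iff (h : Represents U q) {r : ℕ} {e : Fin r → Fin m → 𝕆} :
    RealizesPower q C e ↔ MorleyOver L U C e :=
  forall_congr' fun _ => h.realizesRestriction_iff

end Represents

variable {U : Ultrafilter (ι → 𝕆)}

theorem MorleyOver.mono [LT I] {e : I → ι → 𝕆} (h : MorleyOver L U C e) (hBC : B ⊆ C) :
    MorleyOver L U B e :=
  fun i => (h i).mono (Set.union_subset_union_left _ hBC)

theorem MorleyOver.comp [Preorder I] [Preorder J] {e : I → ι → 𝕆} (h : MorleyOver L U C e)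
    {f : J → I} (hf : StrictMono f) : MorleyOver L U C (e ∘ f) :=
  fun j => (h (f j)).mono <| Set.union_subset_union_right _ <|
    Set.iUnion₂_subset fun k hk => Set.subset_iUnion₂_of_subset (f k) (hf hk) subset_rfl

theorem range_uncurry_coe (s : Set I) (e : I → ι → 𝕆) :
    Set.range (Function.uncurry fun i : s => e i) = ⋃ i ∈ s, Set.range (e i) := by
  ext x
  simp [Set.mem_iUnion]

variable [Finite ι] [Finite γ] {c c' : γ → 𝕆}

theorem MorleyOver.sameType_elim_finset [LinearOrder I] (hU : InvariantOver L U A)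
    (hc : SameType L A c c') {e e' : I → ι → 𝕆} (he : MorleyOver L U (A ∪ Set.range c) e)
    (he' : MorleyOver L U (A ∪ Set.range c') e') (s : Finset I) :
    SameType L A (Sum.elim (Function.uncurry fun i : s => e i) c)
      (Sum.elim (Function.uncurry fun i : s => e' i) c') := by
  induction s using Finset.induction_on_max with
  | empty =>
    have h (e : I → ι → 𝕆) (c : γ → 𝕆) :
        Sum.elim (Function.uncurry fun i : (∅ : Finset I) => e i) c =
          c ∘ Sum.elim (fun p => absurd p.1.2 (Finset.notMem_empty _)) id := by
      ext (p | j)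
      · exact absurd p.1.2 (Finset.notMem_empty _)
      · rfl
    rw [h, h]
    exact hc.comp _
  | insert i s hs ih =>
    have hsub (e : I → ι → 𝕆) (c : γ → 𝕆) :
        A ∪ Set.range (Sum.elim (Function.uncurry fun i : s => e i) c) ⊆
          A ∪ Set.range c ∪ ⋃ j, ⋃ (_ : j < i), Set.range (e j) := by
      rw [Set.Sum.elim_range, Set.union_assoc, Set.union_comm (Set.range c)]
      refine Set.union_subset_union_right _ (Set.union_subset_union_left _ ?_)
      exact (range_uncurry_coe (s : Set I) e).trans_subset
        (Set.biUnion_mono hs fun _ _ => subset_rfl)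
    let f : (↥(insert i s) × ι) ⊕ γ → ι ⊕ (s × ι) ⊕ γ :=
      Sum.elim (fun p => if h : p.1 = i then Sum.inl p.2 else
        Sum.inr (Sum.inl (⟨p.1, Finset.mem_of_mem_insert_of_ne p.1.2 h⟩, p.2)))
        (fun j => Sum.inr (Sum.inr j))
    have hf (e : I → ι → 𝕆) (c : γ → 𝕆) :
        Sum.elim (Function.uncurry fun i : ↥(insert i s) => e i) c =
          Sum.elim (e i) (Sum.elim (Function.uncurry fun i : s => e i) c) ∘ f := by
      ext (p | j)
      · by_cases h : (p.1 : I) = i <;> simp [f, h, Function.uncurry]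
      · rfl
    rw [hf, hf]
    exact (hU.sameType_elim ((he i).mono (hsub e c)) ((he' i).mono (hsub e' c')) ih).comp f

theorem MorleyOver.sameType_elim [LinearOrder I] [Finite I] (hU : InvariantOver L U A)
    (hc : SameType L A c c') {e e' : I → ι → 𝕆} (he : MorleyOver L U (A ∪ Set.range c) e)
    (he' : MorleyOver L U (A ∪ Set.range c') e') :
    SameType L A (Sum.elim (Function.uncurry e) c) (Sum.elim (Function.uncurry e') c') := by
  have := Fintype.ofFinite I
  convert (he.sameType_elim_finset hU hc he' Finset.univ).comp
    (Sum.map (Prod.map (fun i : I => ⟨i, Finset.mem_univ i⟩) id) id) using 1 <;>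
    ext (p | j) <;> rfl

theorem MorleyOver.of_sameType_elim [Preorder I] [Finite I] (hU : InvariantOver L U A)
    {e e' : I → ι → 𝕆} (he : MorleyOver L U (A ∪ Set.range c) e)
    (h : SameType L A (Sum.elim (Function.uncurry e) c) (Sum.elim (Function.uncurry e') c')) :
    MorleyOver L U (A ∪ Set.range c') e' := by
  intro i
  have hr (e : I → ι → 𝕆) (c : γ → 𝕆) :
      A ∪ Set.range c ∪ ⋃ j, ⋃ (_ : j < i), Set.range (e j) =
        A ∪ Set.range (Sum.elim (Function.uncurry fun j : Set.Iio i => e j) c) := by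
    rw [Set.Sum.elim_range, range_uncurry_coe, Set.union_assoc, Set.union_comm (Set.range c)]
    rfl
  have hi := he i
  rw [hr] at hi ⊢
  let f : ι ⊕ (Set.Iio i × ι) ⊕ γ → (I × ι) ⊕ γ :=
    Sum.elim (fun k => Sum.inl (i, k)) (Sum.map (Prod.map (↑) id) id)
  have hf (e : I → ι → 𝕆) (c : γ → 𝕆) :
      Sum.elim (e i) (Sum.elim (Function.uncurry fun j : Set.Iio i => e j) c) =
        Sum.elim (Function.uncurry e) c ∘ f := by
    ext (k | p | j) <;> rfl
  refine hU.realizesOver_congr hi ?_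
  rw [hf, hf]
  exact h.comp f

theorem MorleyOver.sameType_uncurry [LinearOrder I] [Finite I] (hU : InvariantOver L U A)
    {e e' : I → ι → 𝕆} (he : MorleyOver L U A e) (he' : MorleyOver L U A e') :
    SameType L A (Function.uncurry e) (Function.uncurry e') := by
  have h (e : I → ι → 𝕆) (he : MorleyOver L U A e) :
      MorleyOver L U (A ∪ Set.range (Empty.elim : Empty → 𝕆)) e := by
    rwa [Set.range_eq_empty, Set.union_empty]
  exact ((h e he).sameType_elim hU (.refl _) (h e' he')).comp Sum.inl

theorem MorleyOver.of_sameType_uncurry [Preorder I] [Finite I] (hU : InvariantOver L U A)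
    {e e' : I → ι → 𝕆} (he : MorleyOver L U A e)
    (h : SameType L A (Function.uncurry e) (Function.uncurry e')) : MorleyOver L U A e' := by
  rw [← Set.union_empty A, ← Set.range_eq_empty (Empty.elim : Empty → 𝕆)] at he ⊢
  have hf (e : I → ι → 𝕆) : Sum.elim (Function.uncurry e) (Empty.elim : Empty → 𝕆) =
      Function.uncurry e ∘ Sum.elim id Empty.elim := by
    ext (p | j)
    · rfl
    · exact j.elim
  refine he.of_sameType_elim hU ?_
  rw [hf, hf]
  exact h.comp _

end Morley

section Saturation

variable {L : FirstOrder.Language.{u, v}} {𝕆 : Type w} [L.Structure 𝕆] [Nonempty 𝕆] {N F : Set 𝕆}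
  {m : ℕ}

theorem IsSaturated.exists_realizesOver_union (hsat : IsSaturated L (Order.succ (Cardinal.mk N)) 𝕆)
    (hN : N.Infinite) (hF : F.Finite) (U : Ultrafilter (Fin m → 𝕆)) :
    ∃ a, RealizesOver L U (N ∪ F) a := by
  refine hsat.exists_realizesOver U (Order.lt_succ_iff.2 ((Cardinal.mk_union_le _ _).trans ?_))
  have h : Cardinal.aleph0 ≤ Cardinal.mk N := Cardinal.infinite_iff.1 hN.to_subtype
  exact Cardinal.add_le_of_le h le_rfl ((Cardinal.lt_aleph0_iff_set_finite.2 hF).le.trans h)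

theorem IsSaturated.exists_morleyOver (hsat : IsSaturated L (Order.succ (Cardinal.mk N)) 𝕆)
    (hN : N.Infinite) (hF : F.Finite) (U : Ultrafilter (Fin m → 𝕆)) :
    ∃ e : ℕ → Fin m → 𝕆, MorleyOver L U (N ∪ F) e := by
  classical
  obtain ⟨f, hf, hsub⟩ := exists_seq_of_forall_finset_exists
    (fun y : Finset 𝕆 × (Fin m → 𝕆) => RealizesOver L U (N ∪ F ∪ y.1) y.2)
    (fun x y => Set.range x.2 ⊆ y.1) fun s _ => by
      let G : Finset 𝕆 := s.biUnion fun x => Finset.univ.image x.2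
      obtain ⟨a, ha⟩ := hsat.exists_realizesOver_union hN (hF.union G.finite_toSet) U
      refine ⟨(G, a), by rwa [Set.union_assoc], fun x hx => ?_⟩
      rintro _ ⟨i, rfl⟩
      exact Finset.mem_biUnion.2 ⟨x, hx, Finset.mem_image_of_mem _ (Finset.mem_univ i)⟩
  exact ⟨fun i => (f i).2, fun i => (hf i).mono
    (Set.union_subset_union_right _ (Set.iUnion₂_subset fun j hj => hsub j i hj))⟩

theorem IsStronglyBiInvariant.exists_sameType_morleyOver {U : Ultrafilter (Fin m → 𝕆)}
    {p : GlobalType L 𝕆 m} (hp : IsStronglyBiInvariant p N) (hU : Represents U p)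
    (hsat : IsSaturated L (Order.succ (Cardinal.mk N)) 𝕆) (hN : N.Infinite)
    {I : Type*} [LinearOrder I] (s : Finset I) (b : I → Fin m → 𝕆)
    {γ : Type*} [Finite γ] (D : γ → 𝕆) :
    ∃ D' : γ → 𝕆, SameType L N D' D ∧ ∀ X ⊆ (s : Set I),
      MorleyOver L U N (fun i : X => b i) →
        MorleyOver L U (N ∪ Set.range D') (fun i : X => b i) := by
  obtain ⟨k, ⟨f⟩⟩ := Finite.exists_equiv_fin γ
  have hD : Set.range (D ∘ f.symm) = Set.range D := f.symm.surjective.range_comp D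
  obtain ⟨e, he⟩ := hsat.exists_morleyOver hN (Set.finite_range D) U
  have heFin : MorleyOver L U (N ∪ Set.range D) fun i : Fin s.card => e i :=
    he.comp Fin.val_strictMono
  obtain ⟨W, hW, hWD⟩ := invariantlyIndep_iff.1
    (hp.2 _ _ _ (D ∘ f.symm) (hU.realizesPower_iff.2 (by rwa [hD])))
  obtain ⟨D', hD'⟩ := hsat.exists_realizesOver_union hN
    (F := ⋃ i ∈ s, Set.range (b i)) (s.finite_toSet.biUnion fun i _ => Set.finite_range (b i)) W
  refine ⟨D' ∘ f, ?_, fun X hX hbX => ?_⟩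
  · have h := ((hD'.mono Set.subset_union_left).sameType (hWD.mono Set.subset_union_left)).comp f
    rwa [Function.comp_assoc, f.symm_comp_self, Function.comp_id] at h
  have : Finite X := s.finite_toSet.subset hX
  let g : X → Fin s.card := fun i => (s.orderIsoOfFin rfl).symm ⟨i, hX i.2⟩
  have hg : StrictMono g := fun i j hij => (s.orderIsoOfFin rfl).symm.strictMono hij
  have heX := heFin.comp hg
  have hinv : InvariantOver L U N := hU.isInvariant_iff.1 hp.1
  have hsame := (heX.mono Set.subset_union_left).sameType_uncurry hinv hbX
  have hDD' := hW.sameType_elim (hWD.mono ?_) (hD'.mono ?_) hsame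
  · refine heX.of_sameType_elim hinv ?_
    convert hDD'.comp (Sum.elim Sum.inr (Sum.inl ∘ f)) using 1 <;> ext (i | i) <;> simp
  · refine Set.union_subset_union_right _ ?_
    rintro _ ⟨⟨i, j⟩, rfl⟩
    exact Set.mem_iUnion.2 ⟨g i, j, rfl⟩
  · refine Set.union_subset_union_right _ ?_
    rintro _ ⟨⟨i, j⟩, rfl⟩
    exact Set.mem_biUnion (hX i.2) ⟨j, rfl⟩

end Saturation

section MorleyTrees

variable {L : FirstOrder.Language.{u, v}} {𝕆 : Type w} [L.Structure 𝕆] {N : Set 𝕆} {m n : ℕ}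
  {U V : Ultrafilter (Fin m → 𝕆)} {a : Fin m → 𝕆} {b b' : List Bool → Fin m → 𝕆}

/-- A binary tree of height `n` whose antichains, ordered lexicographically, are Morley sequences
over `N` in the type of `U`, and whose chains, read downwards, are Morley sequences over `N` in the
type of `V`. The values of `b` at nodes of length at least `n` play no role. -/
structure IsMorleyTree (L : FirstOrder.Language.{u, v}) {𝕆 : Type w} [L.Structure 𝕆] {m : ℕ}
    (U V : Ultrafilter (Fin m → 𝕆)) (N : Set 𝕆) (n : ℕ) (b : List Bool → Fin m → 𝕆) : Prop where
  antichain : ∀ X ⊆ {σ : List Bool | σ.length < n}, IsAntichain (· <+: ·) X →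
    MorleyOver L U N fun σ : X => b σ
  node : ∀ σ : List Bool, σ.length < n → RealizesOver L V
    (N ∪ ⋃ τ ∈ {τ : List Bool | τ.length < n ∧ σ <+: τ ∧ σ ≠ τ}, Set.range (b τ)) (b σ)

theorem isMorleyTree_zero (b : List Bool → Fin m → 𝕆) : IsMorleyTree L U V N 0 b where
  antichain _ hX _ σ := absurd (hX σ.2) (Nat.not_lt_zero _)
  node _ hσ := absurd hσ (Nat.not_lt_zero _)

theorem IsMorleyTree.chain (h : IsMorleyTree L U V N n b) {Y : Set (List Bool)}
    (hY : Y ⊆ {σ | σ.length < n}) (hchain : IsChain (· <+: ·) Y) :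
    MorleyOver L V N fun σ : Yᵒᵈ => b (OrderDual.ofDual σ).1 := by
  intro σ
  obtain ⟨σ, rfl⟩ := OrderDual.toDual.surjective σ
  refine (h.node σ (hY σ.2)).mono
    (Set.union_subset_union_right _ (Set.iUnion₂_subset fun τ hτ => ?_))
  obtain ⟨τ, rfl⟩ := OrderDual.toDual.surjective τ
  have hlt : (σ : List Bool) < τ := OrderDual.toDual_lt_toDual.1 hτ
  refine Set.subset_biUnion_of_mem (u := fun τ => Set.range (b τ)) ⟨hY τ.2, ?_, hlt.ne⟩
  rcases hchain σ.2 τ.2 hlt.ne with hpre | hpre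
  · exact hpre
  · exact (List.not_lt.2 hpre.le hlt).elim

/-- The entries of a tree of height `n`, as one tuple. -/
def treeTuple (n : ℕ) (b : List Bool → Fin m → 𝕆) : {σ : List Bool // σ.length < n} × Fin m → 𝕆 :=
  fun x => b x.1 x.2

theorem range_subset_range_treeTuple {σ : List Bool} (hσ : σ.length < n) :
    Set.range (b σ) ⊆ Set.range (treeTuple n b) := by
  rintro _ ⟨j, rfl⟩
  exact ⟨(⟨σ, hσ⟩, j), rfl⟩

instance finite_nodes (n : ℕ) : Finite {σ : List Bool // σ.length < n} :=
  (List.finite_length_lt Bool n).to_subtype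

theorem IsMorleyTree.of_sameType (hU : InvariantOver L U N) (hV : InvariantOver L V N)
    (h : IsMorleyTree L U V N n b) (hb : SameType L N (treeTuple n b) (treeTuple n b')) :
    IsMorleyTree L U V N n b' where
  antichain X hX hXa := by
    have : Finite X := (List.finite_length_lt Bool n).subset hX
    exact (h.antichain X hX hXa).of_sameType_uncurry hU
      (hb.comp (Prod.map (fun σ : X => ⟨σ, hX σ.2⟩) id))
  node σ hσ := by
    let Y : Set (List Bool) := {τ | τ.length < n ∧ σ <+: τ ∧ σ ≠ τ}
    have : Finite Y := (List.finite_length_lt Bool n).subset fun _ hτ => hτ.1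
    have hnode := h.node σ hσ
    rw [← range_uncurry_coe Y] at hnode ⊢
    let f : Fin m ⊕ Y × Fin m → {σ : List Bool // σ.length < n} × Fin m :=
      Sum.elim (fun j => (⟨σ, hσ⟩, j)) (Prod.map (fun τ => ⟨τ, τ.2.1⟩) id)
    have hf (b : List Bool → Fin m → 𝕆) :
        Sum.elim (b σ) (Function.uncurry fun τ : Y => b τ) = treeTuple n b ∘ f := by
      ext (j | p) <;> rfl
    refine hV.realizesOver_congr hnode ?_
    rw [hf, hf]
    exact hb.comp f

/-- The tree with root `a` and the subtrees `b` and `b'` above it. -/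
def joinTrees (a : Fin m → 𝕆) (b b' : List Bool → Fin m → 𝕆) : List Bool → Fin m → 𝕆
  | [] => a
  | false :: σ => b σ
  | true :: σ => b' σ

section Join

variable (hb : IsMorleyTree L U V N n b) (hb' : IsMorleyTree L U V N n b')
include hb hb'

theorem IsMorleyTree.joinTrees_antichain
    (haU : RealizesOver L U N a)
    (hbb' : ∀ X ⊆ {σ : List Bool | σ.length < n}, MorleyOver L U N (fun σ : X => b' σ) →
      MorleyOver L U (N ∪ Set.range (treeTuple n b)) fun σ : X => b' σ)
    {X : Set (List Bool)} (hX : X ⊆ {σ | σ.length < n + 1}) (hXa : IsAntichain (· <+: ·) X) :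
    MorleyOver L U N fun σ : X => joinTrees a b b' σ := by
  have hlen (i : Bool) : List.cons i ⁻¹' X ⊆ {σ | σ.length < n} := fun σ hσ =>
    Nat.succ_lt_succ_iff.1 (hX hσ)
  have hanti (i : Bool) : IsAntichain (· <+: ·) (List.cons i ⁻¹' X) := fun σ hσ τ hτ hne hpre =>
    hXa hσ hτ (by simpa using hne) (by simpa using hpre)
  rintro ⟨_ | ⟨_ | _, σ⟩, hσ⟩
  · refine haU.mono (Set.union_subset subset_rfl (Set.iUnion₂_subset fun τ hτ => ?_))
    exact absurd hτ (List.not_lt_nil _)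
  · refine (hb.antichain _ (hlen false) (hanti false) ⟨σ, hσ⟩).mono
      (Set.union_subset_union_right _ (Set.iUnion₂_subset ?_))
    rintro ⟨_ | ⟨_ | _, τ⟩, hτ⟩ hlt
    · exact (hXa hτ hσ (List.cons_ne_nil _ _).symm List.nil_prefix).elim
    · exact Set.subset_iUnion₂_of_subset (⟨τ, hτ⟩ : List.cons false ⁻¹' X)
        (by simpa using hlt) subset_rfl
    · exact absurd (List.cons_lt_cons_iff.1 hlt) (by simp)
  · refine (hbb' _ (hlen true) (hb'.antichain _ (hlen true) (hanti true)) ⟨σ, hσ⟩).mono ?_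
    rw [Set.union_assoc]
    refine Set.union_subset_union_right _ (Set.iUnion₂_subset ?_)
    rintro ⟨_ | ⟨_ | _, τ⟩, hτ⟩ hlt
    · exact (hXa hτ hσ (List.cons_ne_nil _ _).symm List.nil_prefix).elim
    · exact (range_subset_range_treeTuple (hlen false hτ)).trans Set.subset_union_left
    · refine Set.subset_union_of_subset_right ?_ _
      exact Set.subset_iUnion₂_of_subset (⟨τ, hτ⟩ : List.cons true ⁻¹' X)
        (by simpa using hlt) subset_rfl

theorem IsMorleyTree.joinTrees_node
    (haV : RealizesOver L V
      (N ∪ (Set.range (treeTuple n b) ∪ Set.range (treeTuple n b'))) a)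
    {σ : List Bool} (hσ : σ.length < n + 1) :
    RealizesOver L V (N ∪ ⋃ τ ∈ {τ : List Bool | τ.length < n + 1 ∧ σ <+: τ ∧ σ ≠ τ},
      Set.range (joinTrees a b b' τ)) (joinTrees a b b' σ) := by
  rcases σ with _ | ⟨_ | _, σ⟩
  · refine haV.mono (Set.union_subset_union_right _ (Set.iUnion₂_subset ?_))
    rintro (_ | ⟨_ | _, τ⟩) ⟨hlen, -, hne⟩
    · exact absurd rfl hne
    · exact (range_subset_range_treeTuple (Nat.succ_lt_succ_iff.1 hlen)).trans Set.subset_union_left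
    · exact (range_subset_range_treeTuple (Nat.succ_lt_succ_iff.1 hlen)).trans
        Set.subset_union_right
  · refine (hb.node σ (by simpa using hσ)).mono
      (Set.union_subset_union_right _ (Set.iUnion₂_subset ?_))
    rintro (_ | ⟨_ | _, τ⟩) ⟨hlen, hpre, hne⟩
    · simp at hpre
    · exact Set.subset_biUnion_of_mem (u := fun τ => Set.range (b τ))
        (by simpa using And.intro hlen (And.intro hpre hne))
    · simp at hpre
  · refine (hb'.node σ (by simpa using hσ)).mono
      (Set.union_subset_union_right _ (Set.iUnion₂_subset ?_))
    rintro (_ | ⟨_ | _, τ⟩) ⟨hlen, hpre, hne⟩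
    · simp at hpre
    · simp at hpre
    · exact Set.subset_biUnion_of_mem (u := fun τ => Set.range (b' τ))
        (by simpa using And.intro hlen (And.intro hpre hne))

end Join

theorem exists_isMorleyTree [Nonempty 𝕆] {p : GlobalType L 𝕆 m} (hp : IsStronglyBiInvariant p N)
    (hU : Represents U p) (hV : InvariantOver L V N)
    (hsat : IsSaturated L (Order.succ (Cardinal.mk N)) 𝕆) (hN : N.Infinite) {d : Fin m → 𝕆}
    (hdU : RealizesOver L U N d) (hdV : RealizesOver L V N d) (n : ℕ) :
    ∃ b, IsMorleyTree L U V N n b := by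
  induction n with
  | zero => exact ⟨fun _ => d, isMorleyTree_zero _⟩
  | succ n ih =>
    obtain ⟨b', hb'⟩ := ih
    obtain ⟨D, hD, hDM⟩ := hp.exists_sameType_morleyOver hU hsat hN
      (List.finite_length_lt Bool n).toFinset b' (treeTuple n b')
    obtain ⟨b, rfl⟩ : ∃ b : List Bool → Fin m → 𝕆, treeTuple n b = D :=
      ⟨fun σ j => if h : σ.length < n then D (⟨σ, h⟩, j) else d j,
        funext fun x => dif_pos x.1.2⟩
    have hb : IsMorleyTree L U V N n b := hb'.of_sameType (hU.isInvariant_iff.1 hp.1) hV hD.symm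
    obtain ⟨a, ha⟩ := hsat.exists_realizesOver_union hN
      ((Set.finite_range (treeTuple n b)).union (Set.finite_range (treeTuple n b'))) V
    have haU : RealizesOver L U N a :=
      hdU.of_sameType (hdV.sameType (ha.mono Set.subset_union_left))
    refine ⟨joinTrees a b b', fun X hX hXa => hb.joinTrees_antichain hb' haU ?_ hX hXa,
      fun σ hσ => hb.joinTrees_node hb' ha hσ⟩
    rwa [Set.Finite.coe_toFinset] at hDM

end MorleyTrees

section TreeRamsey

/-- Embeddings of the binary tree preserving and reflecting the initial segment relation. -/
def IsTreeEmb (e : List Bool → List Bool) : Prop := ∀ σ τ, e σ <+: e τ ↔ σ <+: τ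

namespace IsTreeEmb

variable {e e' : List Bool → List Bool}

theorem id : IsTreeEmb id := fun _ _ => Iff.rfl

theorem comp (he : IsTreeEmb e) (he' : IsTreeEmb e') : IsTreeEmb (e ∘ e') :=
  fun σ τ => (he _ _).trans (he' σ τ)

theorem cons (i : Bool) : IsTreeEmb (List.cons i) := fun _ _ => by
  rw [List.cons_prefix_cons, eq_self, true_and]

theorem injective (he : IsTreeEmb e) : Function.Injective e := fun σ τ h =>
  antisymm_of (· <+: ·) ((he σ τ).1 (h ▸ List.prefix_rfl)) ((he τ σ).1 (h ▸ List.prefix_rfl))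

end IsTreeEmb

theorem prefix_or_prefix_or_split : ∀ σ τ : List Bool,
    σ <+: τ ∨ τ <+: σ ∨ ∃ ρ i, ρ ++ [i] <+: σ ∧ ρ ++ [!i] <+: τ
  | [], _ => Or.inl List.nil_prefix
  | _ :: _, [] => Or.inr (Or.inl List.nil_prefix)
  | i :: σ, j :: τ => by
    rcases Bool.eq_or_eq_not j i with rfl | rfl
    · rcases prefix_or_prefix_or_split σ τ with h | h | ⟨ρ, k, h, h'⟩
      · exact Or.inl (by simpa using h)
      · exact Or.inr (Or.inl (by simpa using h))
      · exact Or.inr (Or.inr ⟨j :: ρ, k, by simpa using h, by simpa using h'⟩)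
    · exact Or.inr (Or.inr ⟨[], i, by simp, by simp⟩)

theorem isTreeEmb_of_append {e : List Bool → List Bool} (h : ∀ τ i, e τ ++ [i] <+: e (τ ++ [i])) :
    IsTreeEmb e := by
  have mono : ∀ σ τ, σ <+: τ → e σ <+: e τ := by
    rintro σ _ ⟨ρ, rfl⟩
    induction ρ using List.reverseRecOn with
    | nil => simp
    | append_singleton ρ i ih =>
      rw [← List.append_assoc]
      exact ih.trans ((List.prefix_append _ _).trans (h _ i))
  refine fun σ τ => ⟨fun hst => ?_, mono σ τ⟩
  rcases prefix_or_prefix_or_split σ τ with hpre | ⟨_ | ⟨i, ρ⟩, rfl⟩ | ⟨ρ, i, hσ, hτ⟩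
  · exact hpre
  · simp
  · have hloop : e τ ++ [i] <+: e τ := ((h τ i).trans (mono _ _ ⟨ρ, by simp⟩)).trans hst
    simpa using hloop.length_le
  · have hi : e ρ ++ [i] <+: e τ := ((h ρ i).trans (mono _ _ hσ)).trans hst
    have hi' : e ρ ++ [!i] <+: e τ := (h ρ !i).trans (mono _ _ hτ)
    have heq := (List.prefix_of_prefix_length_le hi hi' (by simp)).eq_of_length (by simp)
    simp at heq

variable {γ : Type*} [Finite γ]

theorem exists_dense_color (χ : List Bool → γ) : ∃ c σ, ∀ τ, ∃ ρ, χ (σ ++ τ ++ ρ) = c := by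
  classical
  by_contra! hcon
  have avoid : ∀ s : Finset γ, ∃ σ, ∀ ρ, χ (σ ++ ρ) ∉ s := by
    intro s
    induction s using Finset.induction_on with
    | empty => exact ⟨[], by simp⟩
    | insert c s _ ih =>
      obtain ⟨σ, hσ⟩ := ih
      obtain ⟨τ, hτ⟩ := hcon c σ
      refine ⟨σ ++ τ, fun ρ => ?_⟩
      rw [Finset.mem_insert, not_or]
      refine ⟨hτ ρ, ?_⟩
      rw [List.append_assoc]
      exact hσ _
  have := Fintype.ofFinite γ
  obtain ⟨σ, hσ⟩ := avoid Finset.univ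
  exact hσ [] (Finset.mem_univ _)

theorem exists_monochromatic (χ : List Bool → γ) :
    ∃ c e, IsTreeEmb e ∧ ∀ σ, χ (e σ) = c := by
  obtain ⟨c, σ, h⟩ := exists_dense_color χ
  choose ext hext using h
  let g : List Bool → List Bool :=
    fun t => t.rec (ext []) fun i _ r => r ++ [i] ++ ext (r ++ [i])
  have g_cons : ∀ i t, g (i :: t) = g t ++ [i] ++ ext (g t ++ [i]) := fun _ _ => rfl
  refine ⟨c, fun τ => σ ++ g τ.reverse, isTreeEmb_of_append fun τ i => ?_, fun τ => ?_⟩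
  · simp only [List.reverse_append, List.reverse_cons, List.reverse_nil, List.nil_append,
      List.singleton_append, g_cons]
    exact ⟨ext (g τ.reverse ++ [i]), by simp⟩
  · change χ (σ ++ g τ.reverse) = c
    rcases τ.reverse with _ | ⟨i, t⟩
    · simpa using hext []
    · rw [g_cons, ← List.append_assoc]
      exact hext _

section Pairs

variable (f : List Bool → List Bool → γ) (e : List Bool → List Bool)

theorem exists_rootStep : ∃ c s, IsTreeEmb s ∧ ∀ σ, f (e []) (e (s σ)) = c :=
  exists_monochromatic fun σ => f (e []) (e σ)

/-- The common color of the pairs `e []`, `e (rootStep f e σ)`. -/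
noncomputable def rootColor : γ := (exists_rootStep f e).choose

/-- A subtree of `e` whose nodes all form pairs of the same color with the root of `e`. -/
noncomputable def rootStep : List Bool → List Bool := (exists_rootStep f e).choose_spec.choose

theorem isTreeEmb_rootStep : IsTreeEmb (rootStep f e) :=
  (exists_rootStep f e).choose_spec.choose_spec.1

theorem rootStep_color (σ : List Bool) : f (e []) (e (rootStep f e σ)) = rootColor f e :=
  (exists_rootStep f e).choose_spec.choose_spec.2 σ

/-- The subtree of `e` obtained by passing to `rootStep` above each node in turn: the color of a
pair of comparable nodes depends only on the lower one. -/
noncomputable def endHomogeneous (e : List Bool → List Bool) : List Bool → List Bool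
  | [] => e []
  | i :: η => endHomogeneous (e ∘ rootStep f e ∘ List.cons i) η

/-- The color of the pairs with a given lower member in `endHomogeneous`. -/
noncomputable def endColor (e : List Bool → List Bool) : List Bool → γ
  | [] => rootColor f e
  | i :: η => endColor (e ∘ rootStep f e ∘ List.cons i) η

theorem exists_endHomogeneous_eq : ∀ (e : List Bool → List Bool) (η : List Bool),
    ∃ y, endHomogeneous f e η = e y
  | e, [] => ⟨[], rfl⟩
  | e, i :: η => by
    obtain ⟨y, hy⟩ := exists_endHomogeneous_eq (e ∘ rootStep f e ∘ List.cons i) η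
    exact ⟨_, hy⟩

theorem exists_endHomogeneous_cons_eq (i : Bool) (η : List Bool) :
    ∃ y, endHomogeneous f e (i :: η) = e (rootStep f e (i :: y)) :=
  exists_endHomogeneous_eq f (e ∘ rootStep f e ∘ List.cons i) η

theorem endHomogeneous_prefix_iff : ∀ {e : List Bool → List Bool}, IsTreeEmb e →
    ∀ σ τ : List Bool, endHomogeneous f e σ <+: endHomogeneous f e τ ↔ σ <+: τ
  | e, he, [], τ => by
    obtain ⟨y, hy⟩ := exists_endHomogeneous_eq f e τ
    rw [hy]
    exact iff_of_true ((he _ _).2 List.nil_prefix) List.nil_prefix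
  | e, he, i :: σ, [] => by
    obtain ⟨y, hy⟩ := exists_endHomogeneous_cons_eq f e i σ
    rw [hy]
    refine iff_of_false (fun h => ?_) (by simp)
    have hnil := (isTreeEmb_rootStep f e _ _).1
      (((he _ _).1 h).trans (List.nil_prefix (l := rootStep f e [])))
    simp at hnil
  | e, he, i :: σ, j :: τ => by
    by_cases hij : i = j
    · subst hij
      have hsub := he.comp ((isTreeEmb_rootStep f e).comp (IsTreeEmb.cons i))
      simpa [endHomogeneous] using endHomogeneous_prefix_iff hsub σ τ
    · obtain ⟨y, hy⟩ := exists_endHomogeneous_cons_eq f e i σ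
      obtain ⟨z, hz⟩ := exists_endHomogeneous_cons_eq f e j τ
      rw [hy, hz, he, isTreeEmb_rootStep f e]
      simp [hij]

theorem endHomogeneous_color : ∀ {e : List Bool → List Bool} {σ τ : List Bool}, σ <+: τ → σ ≠ τ →
    f (endHomogeneous f e σ) (endHomogeneous f e τ) = endColor f e σ
  | _, [], [], _, h => absurd rfl h
  | e, [], j :: τ, _, _ => by
    obtain ⟨y, hy⟩ := exists_endHomogeneous_cons_eq f e j τ
    rw [hy]
    exact rootStep_color f e _
  | _, i :: σ, [], h, _ => by simp at h
  | e, i :: σ, j :: τ, h, h' => by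
    obtain ⟨rfl, hστ⟩ : i = j ∧ σ <+: τ := by simpa using h
    have hne : σ ≠ τ := by simpa using h'
    simpa [endHomogeneous, endColor] using endHomogeneous_color hστ hne

theorem exists_pair_homogeneous :
    ∃ c g, IsTreeEmb g ∧ ∀ σ τ, σ <+: τ → σ ≠ τ → f (g σ) (g τ) = c := by
  obtain ⟨c, e, he, hc⟩ := exists_monochromatic (endColor f id)
  refine ⟨c, endHomogeneous f id ∘ e, fun σ τ => ?_, fun σ τ h h' => ?_⟩
  · exact (endHomogeneous_prefix_iff f IsTreeEmb.id _ _).trans (he σ τ)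
  · exact (endHomogeneous_color f ((he σ τ).2 h) (he.injective.ne h')).trans (hc σ)

end Pairs

end TreeRamsey

section Patterns

variable {L : FirstOrder.Language.{u, v}} {T : L.Theory}

theorem exists_realize_of_finite {α : Type} {Γ : Set (L.Formula α)}
    (h : ∀ Δ : Finset (L.Formula α), ↑Δ ⊆ Γ → ∃ (K : Theory.ModelType.{u, v, max u v w} T)
      (a : α → K), ∀ ψ ∈ Δ, ψ.Realize a) :
    ∃ (K : Theory.ModelType.{u, v, max u v w} T) (a : α → K), ∀ ψ ∈ Γ, ψ.Realize a := by
  classical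
  let S (Δ : Finset Γ) : L[[α]].Theory := (L.lhomWithConstants α).onTheory T ∪
    Formula.equivSentence '' (Subtype.val '' (Δ : Set Γ))
  have hS : Directed (· ⊆ ·) S := directed_of_isDirected_le fun Δ Δ' hΔ =>
    Set.union_subset_union_right _ (Set.image_mono (Set.image_mono hΔ))
  have hsat : Theory.IsSatisfiable (⋃ Δ, S Δ) := by
    refine (Theory.isSatisfiable_directed_union_iff hS).2 fun Δ => ?_
    obtain ⟨K, a, ha⟩ := h (Δ.image Subtype.val) (by simp)
    let _ := constantsOn.structure a
    have : K ⊨ S Δ := by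
      refine Theory.model_union_iff.2 ⟨(LHom.onTheory_model _ _).2 K.is_model, ⟨?_⟩⟩
      rintro _ ⟨_, ⟨ψ, hψ, rfl⟩, rfl⟩
      exact (Formula.realize_equivSentence K _).2 (ha _ (Finset.mem_image_of_mem _ hψ))
    exact Theory.Model.isSatisfiable K
  obtain ⟨K₀⟩ := hsat
  let K := Theory.ModelType.ulift.{_, _, _, max u v w} K₀
  let _ : L.Structure K := (L.lhomWithConstants α).reduct K
  have hT : K ⊨ T := (LHom.onTheory_model (L.lhomWithConstants α) T).1
    (K.is_model.mono fun σ hσ => Set.mem_iUnion.2 ⟨∅, Or.inl hσ⟩)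
  refine ⟨Theory.ModelType.of T K, fun i => ((L.con i : L[[α]].Constants) : K), fun ψ hψ => ?_⟩
  refine (Formula.realize_equivSentence K ψ).1 (K.is_model.realize_of_mem _ ?_)
  exact Set.mem_iUnion.2 ⟨{⟨ψ, hψ⟩}, Or.inr ⟨ψ, by simp, rfl⟩⟩

/-- Some tuple realizes `φ(x, b i)` for all `i ∈ P`. -/
def HasCommonRealization {K : Type*} [L.Structure K] {n : ℕ} {ι I : Type*}
    (φ : L.Formula (Fin n ⊕ ι)) (b : I → ι → K) (P : Finset I) : Prop :=
  ∃ x : Fin n → K, ∀ i ∈ P, φ.Realize (Sum.elim x (b i))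

section

variable {K : Type*} [L.Structure K] {n : ℕ} {ι I I' : Type*} {φ : L.Formula (Fin n ⊕ ι)}
  {b : I → ι → K}

theorem HasCommonRealization.mono {P Q : Finset I} (h : HasCommonRealization φ b Q) (hPQ : P ⊆ Q) :
    HasCommonRealization φ b P :=
  h.imp fun _ hx i hi => hx i (hPQ hi)

theorem hasCommonRealization_image [DecidableEq I] {P : Finset I'} {g : I' → I} :
    HasCommonRealization φ b (P.image g) ↔ HasCommonRealization φ (b ∘ g) P := by
  simp [HasCommonRealization]

/-- The formula in the variables `y_{i, j}` saying that `P` has a common realization for the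
tuples `y_i`. -/
noncomputable def commonRealizationFormula (φ : L.Formula (Fin n ⊕ ι)) (P : Finset I) :
    L.Formula (I × ι) :=
  (Formula.iInf fun i : P => φ.relabel (Sum.elim Sum.inr fun j => Sum.inl (i.1, j))).iExs (Fin n)

theorem realize_commonRealizationFormula {P : Finset I} {a : I × ι → K} :
    (commonRealizationFormula φ P).Realize a ↔
      HasCommonRealization φ (Function.curry a) P := by
  have helim (i : I) (x : Fin n → K) : Sum.elim a x ∘ (Sum.elim Sum.inr fun j => Sum.inl (i, j)) =
      Sum.elim x (Function.curry a i) := by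
    rw [Sum.comp_elim, Sum.elim_comp_inr]
    rfl
  simp only [commonRealizationFormula, Formula.realize_iExs, Formula.realize_iInf,
    Formula.realize_relabel, helim, Subtype.forall, HasCommonRealization]

end

theorem exists_pattern_of_finite {n : ℕ} {ι I : Type} (φ : L.Formula (Fin n ⊕ ι))
    {Pos Neg : Set (Finset I)}
    (h : ∀ J : Finset I, ∃ (K : Theory.ModelType.{u, v, max u v w} T) (b : I → ι → K),
      (∀ P ∈ Pos, P ⊆ J → HasCommonRealization φ b P) ∧
        ∀ P ∈ Neg, P ⊆ J → ¬ HasCommonRealization φ b P) :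
    ∃ (K : Theory.ModelType.{u, v, max u v w} T) (b : I → ι → K),
      (∀ P ∈ Pos, HasCommonRealization φ b P) ∧ ∀ P ∈ Neg, ¬ HasCommonRealization φ b P := by
  classical
  let pos (P : Finset I) : L.Formula (I × ι) := commonRealizationFormula φ P
  suffices h' : ∃ (K : Theory.ModelType.{u, v, max u v w} T) (a : I × ι → K),
      ∀ ψ ∈ pos '' Pos ∪ Formula.not ∘ pos '' Neg, ψ.Realize a by
    obtain ⟨K, a, ha⟩ := h'
    exact ⟨K, Function.curry a,
      fun P hP => realize_commonRealizationFormula.1 (ha _ (Or.inl ⟨P, hP, rfl⟩)),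
      fun P hP hc => Formula.realize_not.1 (ha _ (Or.inr ⟨P, hP, rfl⟩))
        (realize_commonRealizationFormula.2 hc)⟩
  refine exists_realize_of_finite fun Δ hΔ => ?_
  obtain ⟨Δ₁, Δ₂, rfl, h₁, h₂⟩ := Finset.subset_union_elim hΔ
  obtain ⟨S₁, hS₁, rfl⟩ := Finset.subset_set_image_iff.1 h₁
  obtain ⟨S₂, hS₂, rfl⟩ := Finset.subset_set_image_iff.1 (h₂.trans Set.sdiff_subset)
  obtain ⟨K, b, hpos, hneg⟩ := h ((S₁ ∪ S₂).sup id)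
  have hle {P} (hP : P ∈ S₁ ∪ S₂) : P ⊆ (S₁ ∪ S₂).sup id := Finset.le_sup (f := id) hP
  refine ⟨K, Function.uncurry b, fun ψ hψ => ?_⟩
  rcases Finset.mem_union.1 hψ with hψ | hψ <;> obtain ⟨P, hP, rfl⟩ := Finset.mem_image.1 hψ
  · exact realize_commonRealizationFormula.2
      (hpos P (hS₁ hP) (hle (Finset.mem_union_left _ hP)))
  · exact Formula.realize_not.2 fun hc => hneg P (hS₂ hP) (hle (Finset.mem_union_right _ hP))
      (realize_commonRealizationFormula.1 hc)

theorem hasATP_of_finite {K : Theory.ModelType.{u, v, w} T} {n : ℕ} {ι : Type*} [Finite ι]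
    (φ : L.Formula (Fin n ⊕ ι)) (b : List Bool → ι → K)
    (hanti : ∀ P : Finset (List Bool), IsAntichain (· <+: ·) (P : Set (List Bool)) →
      HasCommonRealization φ b P)
    (hchain : ∀ σ τ, σ <+: τ → σ ≠ τ → ¬ HasCommonRealization φ b {σ, τ}) :
    HasATP.{u, v, w} T := by
  obtain ⟨m, ⟨e⟩⟩ := Finite.exists_equiv_fin ι
  have hrealize (σ x) : (φ.relabel (Sum.map id e)).Realize (Sum.elim x (b σ ∘ e.symm)) ↔
      φ.Realize (Sum.elim x (b σ)) := by
    rw [Formula.realize_relabel, Sum.elim_comp_map, Function.comp_id, Function.comp_assoc,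
      e.symm_comp_self, Function.comp_id]
  refine ⟨K, n, m, φ.relabel (Sum.map id e), fun σ => b σ ∘ e.symm, fun X hX s hs => ?_, ?_⟩
  · obtain ⟨x, hx⟩ := hanti s (hX.subset hs)
    exact ⟨x, fun i hi => (hrealize i x).2 (hx i hi)⟩
  · rintro σ τ hστ hne ⟨x, hσ, hτ⟩
    refine hchain σ τ hστ hne ⟨x, ?_⟩
    simpa only [Finset.forall_mem_insert, Finset.mem_singleton, forall_eq] using
      ⟨(hrealize σ x).1 hσ, (hrealize τ x).1 hτ⟩

end Patterns

section TreePatterns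

variable {L : FirstOrder.Language.{u, v}} {T : L.Theory}

/-- The strict initial segment relation between the nodes of a tree carried by two indices. -/
def ProperPrefix {I : Type*} (node : I → List Bool) (i j : I) : Prop :=
  node i <+: node j ∧ node i ≠ node j

/-- A family of parameters, each attached to a node of the binary tree, for which `φ` is consistent
along antichains but not along `k` indices on a branch. Several parameters may share a node: they
are compatible with each other in an antichain, and all count in a chain. Only the indices in `D`
are considered. -/
structure IsTreePattern {K : Type*} [L.Structure K] {n : ℕ} {ι I : Type*}
    (φ : L.Formula (Fin n ⊕ ι)) (node : I → List Bool) (D : Set I) (k : ℕ) (b : I → ι → K) :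
    Prop where
  antichain : ∀ P : Finset I, ↑P ⊆ D → IsAntichain (ProperPrefix node) (P : Set I) →
    HasCommonRealization φ b P
  chain : ∀ P : Finset I, ↑P ⊆ D → IsChain (fun i j => node i <+: node j) (P : Set I) →
    k ≤ P.card → ¬ HasCommonRealization φ b P

/-- Existence of an `IsTreePattern` in a model of `T`. -/
def HasTreePattern (T : L.Theory) {n : ℕ} {ι I : Type*} (φ : L.Formula (Fin n ⊕ ι))
    (node : I → List Bool) (D : Set I) (k : ℕ) : Prop :=
  ∃ (K : Theory.ModelType.{u, v, w} T) (b : I → ι → K), IsTreePattern φ node D k b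

theorem IsTreePattern.comp {K : Type*} [L.Structure K] {n : ℕ} {ι I I' : Type*}
    {φ : L.Formula (Fin n ⊕ ι)} {node : I → List Bool} {D : Set I} {k : ℕ} {b : I → ι → K}
    (h : IsTreePattern φ node D k b) {g : I' → I} {D' : Set I'} (hinj : D'.InjOn g)
    (hmaps : D'.MapsTo g D) : IsTreePattern φ (node ∘ g) D' k (b ∘ g) := by
  classical
  have himage {P : Finset I'} (hP : ↑P ⊆ D') : ↑(P.image g) ⊆ D := by
    rw [Finset.coe_image]
    exact (hmaps.mono_left hP).image_subset
  refine ⟨fun P hP hanti => ?_, fun P hP hchain hk => ?_⟩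
  · refine hasCommonRealization_image.1 (h.antichain _ (himage hP) ?_)
    rw [Finset.coe_image]
    exact hanti.image g fun _ _ h => h
  · refine mt hasCommonRealization_image.2 (h.chain _ (himage hP) ?_ ?_)
    · rw [Finset.coe_image]
      exact hchain.image_of_map_rel _ _ g fun _ _ h => h
    · rwa [Finset.card_image_of_injOn (hinj.mono hP)]

theorem hasTreePattern_of_finite {n : ℕ} {ι I : Type} {φ : L.Formula (Fin n ⊕ ι)}
    {node : I → List Bool} {D : Set I} {k : ℕ}
    (h : ∀ J : Finset I, HasTreePattern.{u, v, max u v w} T φ node (D ∩ J) k) :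
    HasTreePattern.{u, v, max u v w} T φ node D k := by
  let Pos : Set (Finset I) := {P | ↑P ⊆ D ∧ IsAntichain (ProperPrefix node) (P : Set I)}
  let Neg : Set (Finset I) :=
    {P | ↑P ⊆ D ∧ IsChain (fun i j => node i <+: node j) (P : Set I) ∧ k ≤ P.card}
  obtain ⟨K, b, hpos, hneg⟩ := exists_pattern_of_finite.{u, v, w} (T := T) φ
    (Pos := Pos) (Neg := Neg) fun J => by
      obtain ⟨K, b, hb⟩ := h J
      exact ⟨K, b, fun P ⟨hP, hanti⟩ hPJ => hb.antichain P (Set.subset_inter hP hPJ) hanti,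
        fun P ⟨hP, hchain, hk⟩ hPJ => hb.chain P (Set.subset_inter hP hPJ) hchain hk⟩
  exact ⟨K, b, fun P hP h => hpos P ⟨hP, h⟩, fun P hP h hk => hneg P ⟨hP, h, hk⟩⟩

/-- The index set of a tree in which the nodes in `F` carry two parameters, and the others one. -/
def fatNodes (F : Set (List Bool)) : Set (List Bool × Bool) := {p | p.2 = true → p.1 ∈ F}

theorem HasTreePattern.fatNodes_empty {n : ℕ} {ι : Type*} {φ : L.Formula (Fin n ⊕ ι)} {k : ℕ}
    (h : HasTreePattern.{u, v, w} T φ id Set.univ k) :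
    HasTreePattern.{u, v, w} T φ Prod.fst (fatNodes ∅) k := by
  obtain ⟨K, b, hb⟩ := h
  refine ⟨K, b ∘ Prod.fst, hb.comp (g := Prod.fst) ?_ (Set.mapsTo_univ _ _)⟩
  rintro ⟨σ, i⟩ hi ⟨τ, j⟩ hj h
  simp only [fatNodes, Set.mem_empty_iff_false, imp_false, Bool.not_eq_true,
    Set.mem_ofPred_eq] at hi hj
  exact Prod.ext h (hi.trans hj.symm)

section Fatten

/-- The map moving the cone above `η` to the cone above `u`. -/
def moveCone (η u σ : List Bool) : List Bool :=
  open Classical in if η <+: σ then u ++ σ.drop η.length else σ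

variable {η u u' : List Bool} {p q : List Bool × Bool}

theorem moveCone_of_not_prefix {σ : List Bool} (h : ¬ η <+: σ) : moveCone η u σ = σ := if_neg h

theorem moveCone_append (η u ρ : List Bool) : moveCone η u (η ++ ρ) = u ++ ρ := by
  rw [moveCone, if_pos (List.prefix_append _ _), List.drop_left]

theorem prefix_append_iff_of_not_prefix {σ : List Bool} (hσ : ¬ η <+: σ) (ρ : List Bool) :
    σ <+: η ++ ρ ↔ σ <+: η := by
  refine ⟨fun h => ?_, fun h => h.trans (List.prefix_append _ _)⟩
  exact (List.prefix_or_prefix_of_prefix h (List.prefix_append _ _)).resolve_right hσ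

theorem prefix_of_prefix_append {σ : List Bool} (hu : η <+: u) (hσ : ¬ η <+: σ) {ρ : List Bool}
    (h : σ <+: u ++ ρ) : σ <+: η := by
  obtain ⟨υ, rfl⟩ := hu
  rwa [List.append_assoc, prefix_append_iff_of_not_prefix hσ] at h

theorem isTreeEmb_moveCone (hu : η <+: u) : IsTreeEmb (moveCone η u) := by
  intro σ τ
  by_cases hσ : η <+: σ <;> by_cases hτ : η <+: τ
  · obtain ⟨ρ, rfl⟩ := hσ
    obtain ⟨ρ', rfl⟩ := hτ
    simp only [moveCone_append, List.prefix_append_right_inj]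
  · obtain ⟨ρ, rfl⟩ := hσ
    rw [moveCone_append, moveCone_of_not_prefix hτ]
    exact iff_of_false (fun h => hτ (hu.trans ((List.prefix_append _ _).trans h)))
      (fun h => hτ ((List.prefix_append _ _).trans h))
  · obtain ⟨ρ, rfl⟩ := hτ
    rw [moveCone_append, moveCone_of_not_prefix hσ, prefix_append_iff_of_not_prefix hσ]
    exact ⟨prefix_of_prefix_append hu hσ, fun h => (h.trans hu).trans (List.prefix_append _ _)⟩
  · rw [moveCone_of_not_prefix hσ, moveCone_of_not_prefix hτ]

/-- The map placing the two indices at `η` on the nodes `u` and `u'`, and the indices strictly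
above `η` above `u'`. -/
def fatten (η u u' : List Bool) (p : List Bool × Bool) : List Bool × Bool :=
  open Classical in if p.1 = η then (if p.2 then u' else u, false) else (moveCone η u' p.1, p.2)

theorem fatten_of_ne (h : p.1 ≠ η) : fatten η u u' p = (moveCone η u' p.1, p.2) := if_neg h

theorem fatten_false : fatten η u u' (η, false) = (u, false) := if_pos rfl

theorem fatten_true : fatten η u u' (η, true) = (u', false) := if_pos rfl

theorem prefix_fatten (hu' : u <+: u') (h : η <+: p.1) : u <+: (fatten η u u' p).1 := by
  obtain ⟨σ, i⟩ := p
  by_cases hσ : σ = η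
  · subst hσ
    cases i
    · rw [fatten_false]
    · rwa [fatten_true]
  · obtain ⟨ρ, rfl⟩ := h
    rw [fatten_of_ne hσ, moveCone_append]
    exact hu'.trans (List.prefix_append _ _)

theorem fatten_comparable (hu : η <+: u) (hu' : u <+: u') (h : p.1 <+: q.1) :
    (fatten η u u' p).1 <+: (fatten η u u' q).1 ∨ (fatten η u u' q).1 <+: (fatten η u u' p).1 := by
  obtain ⟨σ, i⟩ := p
  obtain ⟨τ, j⟩ := q
  by_cases hσ : σ = η <;> by_cases hτ : τ = η
  · subst hσ hτ
    cases i <;> cases j <;> simp [fatten_false, fatten_true, hu']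
  · subst hσ
    obtain ⟨ρ, rfl⟩ : σ <+: τ := h
    cases i
    · rw [fatten_false, fatten_of_ne hτ, moveCone_append]
      exact Or.inl (hu'.trans (List.prefix_append _ _))
    · rw [fatten_true, fatten_of_ne hτ, moveCone_append]
      exact Or.inl (List.prefix_append _ _)
  · subst hτ
    have hτσ : ¬ τ <+: σ := fun h' => hσ (antisymm_of (· <+: ·) h h')
    rw [fatten_of_ne hσ, moveCone_of_not_prefix hτσ]
    exact Or.inl ((h.trans hu).trans (prefix_fatten hu' List.prefix_rfl))
  · rw [fatten_of_ne hσ, fatten_of_ne hτ]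
    exact Or.inl ((isTreeEmb_moveCone (hu.trans hu') _ _).2 h)

theorem fatten_ne (hu : η <+: u) (hu' : u <+: u') (i : Bool) (hq : q.1 ≠ η) :
    fatten η u u' (η, i) ≠ fatten η u u' q := by
  intro h
  have hlower : u <+: (fatten η u u' q).1 := h ▸ prefix_fatten hu' List.prefix_rfl
  have hupper : (fatten η u u' q).1 <+: u' := by
    rw [← h]
    cases i
    · rwa [fatten_false]
    · rw [fatten_true]
  rw [fatten_of_ne hq] at hlower hupper
  by_cases hη : η <+: q.1
  · obtain ⟨ρ, hρ⟩ := hη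
    rw [← hρ, moveCone_append] at hupper
    have hnil : ρ = [] := by simpa using hupper.length_le
    exact hq (by simpa [hnil] using hρ.symm)
  · rw [moveCone_of_not_prefix hη] at hlower
    exact hη (hu.trans hlower)

theorem fatten_injective (hu : η <+: u) (hu' : u <+: u') (hne : u ≠ u') :
    Function.Injective (fatten η u u') := by
  rintro ⟨σ, i⟩ ⟨τ, j⟩ h
  by_cases hσ : σ = η <;> by_cases hτ : τ = η
  · subst hσ hτ
    cases i <;> cases j <;> simp_all [fatten_false, fatten_true]
  · subst hσ
    exact absurd h (fatten_ne hu hu' i hτ)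
  · subst hτ
    exact absurd h.symm (fatten_ne hu hu' j hσ)
  · rw [fatten_of_ne hσ, fatten_of_ne hτ, Prod.mk.injEq] at h
    exact Prod.ext ((isTreeEmb_moveCone (hu.trans hu')).injective h.1) h.2

theorem mapsTo_fatten_fatNodes {F : Set (List Bool)} (hF : ∀ σ ∈ F, ¬ η <+: σ) :
    Set.MapsTo (fatten η u u') (fatNodes (insert η F)) (fatNodes F) := by
  rintro ⟨σ, i⟩ hσi
  by_cases hσ : σ = η
  · subst hσ
    cases i <;> simp [fatten_false, fatten_true, fatNodes]
  · rw [fatten_of_ne hσ]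
    intro hi
    have hσF : σ ∈ F := (hσi hi).resolve_left hσ
    rwa [moveCone_of_not_prefix (hF σ hσF)]

end Fatten

section GoodPairs

variable {n : ℕ} {ι : Type*} {φ : L.Formula (Fin n ⊕ ι)} {F : Set (List Bool)} {k : ℕ}
  {η : List Bool}

/-- The formula `φ(x, y) ∧ ⋀_{p ∈ P} φ(x, y_p)`. -/
noncomputable def conjFormula {I : Type*} (φ : L.Formula (Fin n ⊕ ι)) (P : Finset I) :
    L.Formula (Fin n ⊕ (ι ⊕ P × ι)) :=
  φ.relabel (Sum.map id Sum.inl) ⊓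
    Formula.iInf fun p : P => φ.relabel (Sum.elim Sum.inl fun j => Sum.inr (Sum.inr (p, j)))

theorem realize_conjFormula {K I : Type*} [L.Structure K] {P : Finset I} {x : Fin n → K}
    {y : ι → K} {b : I → ι → K} :
    (conjFormula φ P).Realize (Sum.elim x (Sum.elim y fun pj => b pj.1 pj.2)) ↔
      φ.Realize (Sum.elim x y) ∧ ∀ p ∈ P, φ.Realize (Sum.elim x (b p)) := by
  simp only [conjFormula, Formula.realize_inf, Formula.realize_iInf, Formula.realize_relabel,
    Sum.elim_comp_map, Sum.comp_elim, Sum.elim_comp_inl, Function.comp_id, Subtype.forall]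
  rfl

theorem isAntichain_image_append_union {g : List Bool → List Bool} (hg : IsTreeEmb g)
    {P : Set (List Bool × Bool)} (hP : IsAntichain (ProperPrefix Prod.fst) P)
    (hPη : ∀ p ∈ P, IncompRel (· <+: ·) η p.1) {X : Set (List Bool)}
    (hX : IsAntichain (· <+: ·) X) :
    IsAntichain (ProperPrefix Prod.fst) ((fun σ => (η ++ g σ, false)) '' X ∪ P) := by
  rw [isAntichain_union]
  refine ⟨hX.image _ fun σ τ h => ?_, hP, ?_⟩
  · exact (hg _ _).1 ((List.prefix_append_right_inj _).1 h.1)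
  · rintro _ ⟨σ, _, rfl⟩ p hp _
    refine ⟨fun h => (hPη p hp).1 ((List.prefix_append _ _).trans h.1), fun h => ?_⟩
    rcases List.prefix_or_prefix_of_prefix h.1 (List.prefix_append η (g σ)) with h | h
    · exact (hPη p hp).2 h
    · exact (hPη p hp).1 h

theorem hasATP_of_inconsistent_pairs {ι : Type} [Finite ι] {φ : L.Formula (Fin n ⊕ ι)}
    {K : Theory.ModelType.{u, v, w} T} {b : List Bool × Bool → ι → K}
    (hb : IsTreePattern φ Prod.fst (fatNodes F) k b) {P : Finset (List Bool × Bool)}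
    (hPF : ↑P ⊆ fatNodes F) (hP : IsAntichain (ProperPrefix Prod.fst) (P : Set (List Bool × Bool)))
    (hPη : ∀ p ∈ P, IncompRel (· <+: ·) η p.1) {g : List Bool → List Bool} (hg : IsTreeEmb g)
    (hpairs : ∀ σ τ, σ <+: τ → σ ≠ τ →
      ¬ HasCommonRealization φ b ({(η ++ g σ, false), (η ++ g τ, false)} ∪ P)) :
    HasATP.{u, v, w} T := by
  classical
  refine hasATP_of_finite (conjFormula φ P)
    (fun σ => Sum.elim (b (η ++ g σ, false)) fun pj => b pj.1 pj.2) (fun X hX => ?_) ?_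
  · have hsub : ↑(X.image (fun σ => (η ++ g σ, false)) ∪ P) ⊆ fatNodes F := by
      rw [Finset.coe_union, Finset.coe_image, Set.union_subset_iff, Set.image_subset_iff]
      exact ⟨fun σ _ h => absurd h Bool.false_ne_true, hPF⟩
    obtain ⟨x, hx⟩ := hb.antichain _ hsub (by
      rw [Finset.coe_union, Finset.coe_image]
      exact isAntichain_image_append_union hg hP hPη hX)
    exact ⟨x, fun σ hσ => realize_conjFormula.2
      ⟨hx _ (Finset.mem_union_left _ (Finset.mem_image_of_mem _ hσ)),
        fun p hp => hx p (Finset.mem_union_right _ hp)⟩⟩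
  · rintro σ τ hστ hne ⟨x, hx⟩
    obtain ⟨hσ, hxP⟩ := realize_conjFormula.1 (hx σ (by simp))
    obtain ⟨hτ, _⟩ := realize_conjFormula.1 (hx τ (by simp))
    refine hpairs σ τ hστ hne ⟨x, fun p hp => ?_⟩
    simp only [Finset.mem_union, Finset.mem_insert, Finset.mem_singleton] at hp
    rcases hp with (rfl | rfl) | hp
    exacts [hσ, hτ, hxP p hp]

theorem exists_consistent_pair (hT : ¬ HasATP.{u, v, w} T) {ι : Type} [Finite ι]
    {φ : L.Formula (Fin n ⊕ ι)} {K : Theory.ModelType.{u, v, w} T} {b : List Bool × Bool → ι → K}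
    (hb : IsTreePattern φ Prod.fst (fatNodes F) k b) (η : List Bool)
    (J : Finset (List Bool × Bool)) :
    ∃ u u', η <+: u ∧ u <+: u' ∧ u ≠ u' ∧ ∀ P ⊆ J, ↑P ⊆ fatNodes F →
      IsAntichain (ProperPrefix Prod.fst) (P : Set (List Bool × Bool)) →
      (∀ p ∈ P, IncompRel (· <+: ·) η p.1) →
      HasCommonRealization φ b ({(u, false), (u', false)} ∪ P) := by
  classical
  by_contra! hbad
  have hcolor (ρ ρ' : List Bool) : ∃ P : J.powerset, ρ <+: ρ' → ρ ≠ ρ' →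
      ↑P.1 ⊆ fatNodes F ∧ IsAntichain (ProperPrefix Prod.fst) (P.1 : Set (List Bool × Bool)) ∧
        (∀ p ∈ P.1, IncompRel (· <+: ·) η p.1) ∧
        ¬ HasCommonRealization φ b ({(η ++ ρ, false), (η ++ ρ', false)} ∪ P.1) := by
    by_cases h : ρ <+: ρ' ∧ ρ ≠ ρ'
    · obtain ⟨P, hPJ, hP⟩ := hbad (η ++ ρ) (η ++ ρ') (List.prefix_append _ _)
        ((List.prefix_append_right_inj _).2 h.1) (by simpa using h.2)
      exact ⟨⟨P, Finset.mem_powerset.2 hPJ⟩, fun _ _ => hP⟩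
    · exact ⟨⟨∅, Finset.empty_mem_powerset J⟩, fun h₁ h₂ => absurd ⟨h₁, h₂⟩ h⟩
  choose color hcolor using hcolor
  obtain ⟨P, g, hg, hP⟩ := exists_pair_homogeneous color
  have hpairs (σ τ : List Bool) (h : σ <+: τ) (hne : σ ≠ τ) :=
    hP σ τ h hne ▸ hcolor (g σ) (g τ) ((hg σ τ).2 h) (hg.injective.ne hne)
  obtain ⟨hPF, hanti, hPη, -⟩ := hpairs [] [true] (by simp) (by simp)
  exact hT (hasATP_of_inconsistent_pairs hb hPF hanti hPη hg
    fun σ τ h hne => (hpairs σ τ h hne).2.2.2)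

theorem IsTreePattern.comp_fatten {K : Type*} [L.Structure K] {b : List Bool × Bool → ι → K}
    (hb : IsTreePattern φ Prod.fst (fatNodes F) k b) (hF : ∀ σ ∈ F, ¬ η <+: σ)
    {u u' : List Bool} (hu : η <+: u) (hu' : u <+: u') (hne : u ≠ u')
    {J : Finset (List Bool × Bool)}
    (hpair : ∀ P ⊆ J, ↑P ⊆ fatNodes F →
      IsAntichain (ProperPrefix Prod.fst) (P : Set (List Bool × Bool)) →
      (∀ p ∈ P, IncompRel (· <+: ·) η p.1) →
      HasCommonRealization φ b ({(u, false), (u', false)} ∪ P)) :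
    IsTreePattern φ Prod.fst (fatNodes (insert η F) ∩ J) k (b ∘ fatten η u u') := by
  classical
  have hfat := hb.comp (fatten_injective hu hu' hne).injOn (mapsTo_fatten_fatNodes hF)
  refine ⟨fun P hP hanti => ?_, fun P hP hchain => ?_⟩
  · obtain ⟨hPF, hPJ⟩ := Set.subset_inter_iff.1 hP
    by_cases hη : ∃ p ∈ P, p.1 = η
    · obtain ⟨p₀, hp₀, rfl⟩ := hη
      have hincomp {p} (hp : p ∈ P) (hne : p.1 ≠ p₀.1) : IncompRel (· <+: ·) p₀.1 p.1 :=
        ⟨fun h => hanti hp₀ hp (fun h' => hne (h' ▸ rfl)) ⟨h, hne.symm⟩,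
          fun h => hanti hp hp₀ (fun h' => hne (h' ▸ rfl)) ⟨h, hne⟩⟩
      have hQ := Finset.filter_subset (fun p => p.1 ≠ p₀.1) P
      refine hasCommonRealization_image.1 ((hpair (P.filter fun p => p.1 ≠ p₀.1) (hQ.trans hPJ)
        (fun p hp hp₂ => ?_) (hanti.subset hQ) fun p hp => ?_).mono ?_)
      · obtain ⟨hp, hne⟩ := Finset.mem_filter.1 hp
        exact (hPF hp hp₂).resolve_left hne
      · obtain ⟨hp, hne⟩ := Finset.mem_filter.1 hp
        exact hincomp hp hne
      · intro q hq
        obtain ⟨⟨σ, i⟩, hp, rfl⟩ := Finset.mem_image.1 hq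
        by_cases hσ : σ = p₀.1
        · subst hσ
          cases i <;> simp [fatten_false, fatten_true]
        · rw [fatten_of_ne hσ, moveCone_of_not_prefix (hincomp hp hσ).1]
          simp [hp, hσ]
    · push Not at hη
      refine hfat.antichain P hPF (hanti.mono_on fun p hp q hq _ h => ?_)
      simp only [ProperPrefix, Function.comp_apply, fatten_of_ne (hη p hp), fatten_of_ne (hη q hq),
        isTreeEmb_moveCone (hu.trans hu') _ _] at h
      exact ⟨h.1, fun h' => h.2 (h' ▸ rfl)⟩
  · refine hfat.chain P (hP.trans Set.inter_subset_left) fun p hp q hq hne => ?_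
    rcases hchain hp hq hne with h | h
    · exact fatten_comparable hu hu' h
    · exact (fatten_comparable hu hu' h).symm

end GoodPairs

section Doubling

variable {n : ℕ} {ι : Type} {φ : L.Formula (Fin n ⊕ ι)} {k : ℕ}

theorem HasTreePattern.fatNodes_insert (hT : ¬ HasATP.{u, v, max u v w} T) [Finite ι]
    {F : Set (List Bool)}
    (h : HasTreePattern.{u, v, max u v w} T φ Prod.fst (fatNodes F) k) {η : List Bool}
    (hF : ∀ σ ∈ F, ¬ η <+: σ) :
    HasTreePattern.{u, v, max u v w} T φ Prod.fst (fatNodes (insert η F)) k := by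
  obtain ⟨K, b, hb⟩ := h
  refine hasTreePattern_of_finite fun J => ?_
  obtain ⟨u, u', hu, hu', hne, hpair⟩ := exists_consistent_pair hT hb η J
  exact ⟨K, _, hb.comp_fatten hF hu hu' hne hpair⟩

theorem HasTreePattern.fatNodes_length_lt (hT : ¬ HasATP.{u, v, max u v w} T) [Finite ι]
    (h : HasTreePattern.{u, v, max u v w} T φ Prod.fst (fatNodes ∅) k) (l : ℕ) :
    HasTreePattern.{u, v, max u v w} T φ Prod.fst (fatNodes {σ | σ.length < l}) k := by
  classical
  induction l with
  | zero => simpa using h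
  | succ l ih =>
    suffices hlevel : ∀ S : Finset (List Bool), (∀ σ ∈ S, σ.length = l) →
        HasTreePattern.{u, v, max u v w} T φ Prod.fst (fatNodes ({σ | σ.length < l} ∪ S)) k by
      convert hlevel (List.finite_length_eq Bool l).toFinset (by simp) using 2
      ext σ
      simp only [Set.mem_ofPred_eq, Set.Finite.coe_toFinset, Set.mem_union]
      omega
    intro S
    induction S using Finset.induction_on with
    | empty => simpa using ih
    | insert η S hη ihS =>
      intro hS
      rw [Finset.coe_insert, Set.union_insert]
      refine (ihS fun σ hσ => hS σ (Finset.mem_insert_of_mem hσ)).fatNodes_insert hT ?_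
      have hlen : η.length = l := hS η (Finset.mem_insert_self _ _)
      rintro σ (hσ | hσ) hpre
      · exact absurd hpre.length_le (not_le.2 (hlen ▸ hσ))
      · rw [← hpre.eq_of_length (hlen.trans (hS σ (Finset.mem_insert_of_mem hσ)).symm)] at hσ
        exact hη hσ

/-- The formula `φ(x, y) ∧ φ(x, y')`. -/
def double (φ : L.Formula (Fin n ⊕ ι)) : L.Formula (Fin n ⊕ (ι ⊕ ι)) :=
  φ.relabel (Sum.map id Sum.inl) ⊓ φ.relabel (Sum.map id Sum.inr)

theorem hasCommonRealization_double {K : Type*} [L.Structure K] {I : Type*} {b : I × Bool → ι → K}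
    {P : Finset I} :
    HasCommonRealization (double φ) (fun i => Sum.elim (b (i, false)) (b (i, true))) P ↔
      HasCommonRealization φ b (P ×ˢ Finset.univ) := by
  simp only [HasCommonRealization, double, Formula.realize_inf, Formula.realize_relabel,
    Sum.elim_comp_map, Sum.elim_comp_inl, Sum.elim_comp_inr, Function.comp_id, Finset.mem_product,
    Finset.mem_univ, and_true, Prod.forall, Bool.forall_bool, forall_and]

theorem HasTreePattern.double (hT : ¬ HasATP.{u, v, max u v w} T) [Finite ι]
    (h : HasTreePattern.{u, v, max u v w} T φ id Set.univ (2 * k)) :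
    HasTreePattern.{u, v, max u v w} T (double φ) id Set.univ k := by
  refine hasTreePattern_of_finite fun J => ?_
  obtain ⟨K, b, hb⟩ := h.fatNodes_empty.fatNodes_length_lt hT (J.sup List.length + 1)
  have hsub {P : Finset (List Bool)} (hP : ↑P ⊆ Set.univ ∩ (J : Set (List Bool))) :
      ↑(P ×ˢ (Finset.univ : Finset Bool)) ⊆ fatNodes {σ | σ.length < J.sup List.length + 1} :=
    fun p hp _ => Nat.lt_succ_of_le (Finset.le_sup (hP (Finset.mem_product.1 hp).1).2)
  refine ⟨K, fun σ => Sum.elim (b (σ, false)) (b (σ, true)), fun P hP hanti => ?_,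
    fun P hP hchain hk => ?_⟩
  · refine hasCommonRealization_double.2 (hb.antichain _ (hsub hP) fun p hp q hq _ hpq => ?_)
    exact hanti (Finset.mem_product.1 hp).1 (Finset.mem_product.1 hq).1 hpq.2 hpq
  · refine mt hasCommonRealization_double.1 (hb.chain _ (hsub hP) (fun p hp q hq _ => ?_) ?_)
    · exact hchain.total (Finset.mem_product.1 hp).1 (Finset.mem_product.1 hq).1
    · rw [Finset.card_product, Finset.card_univ, Fintype.card_bool]
      omega

theorem HasTreePattern.hasATP [Finite ι]
    (h : HasTreePattern.{u, v, max u v w} T φ id Set.univ k) : HasATP.{u, v, max u v w} T := by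
  by_contra hT
  have hpow (i : ℕ) : ∀ (ι : Type) [Finite ι] (φ : L.Formula (Fin n ⊕ ι)),
      ¬ HasTreePattern.{u, v, max u v w} T φ id Set.univ (2 ^ i) := by
    induction i with
    | zero =>
      rintro ι _ φ ⟨K, b, hb⟩
      exact hb.chain {[]} (Set.subset_univ _) (by simp) (by simp)
        (hb.antichain {[]} (Set.subset_univ _) (by simp))
    | succ i ih =>
      intro ι _ φ h
      rw [pow_succ'] at h
      exact ih _ _ (h.double hT)
  obtain ⟨K, b, hb⟩ := h
  exact hpow k ι φ ⟨K, b, hb.antichain,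
    fun P hP hchain hk => hb.chain P hP hchain (k.lt_two_pow_self.le.trans hk)⟩

end Doubling

end TreePatterns

section KimDividing

variable {L : FirstOrder.Language.{u, v}} {𝕆 : Type w} [L.Structure 𝕆] {n m : ℕ} {A : Set 𝕆}

theorem consistentOn_onFormula_iff {φ : L.Formula (Fin n ⊕ Fin m)} {e : ℕ → Fin m → 𝕆} :
    ConsistentOn ((L.lhomWithConstants A).onFormula φ) e Set.univ ↔
      ∀ k, HasCommonRealization φ e (Finset.range k) := by
  simp only [ConsistentOn, LHom.realize_onFormula]
  refine ⟨fun h k => h _ (Set.subset_univ _), fun h s _ => ?_⟩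
  obtain ⟨k, hk⟩ := s.exists_nat_subset_range
  exact (h k).mono hk

theorem Represents.kimDividesAlong_iff {φ : L.Formula (Fin n ⊕ Fin m)} {q : GlobalType L 𝕆 m}
    {V : Ultrafilter (Fin m → 𝕆)} (hV : Represents V q) :
    KimDividesAlong A ((L.lhomWithConstants A).onFormula φ) q ↔
      ∃ e, MorleyOver L V A e ∧ ∃ k, ¬ HasCommonRealization φ e (Finset.range k) := by
  simp only [KimDividesAlong, hV.isMorleySequence_iff, consistentOn_onFormula_iff, not_forall]

variable {ι I : Type*} {φ : L.Formula (Fin n ⊕ ι)}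

theorem SameType.hasCommonRealization_iff {b b' : I → ι → 𝕆}
    (h : SameType L A (Function.uncurry b) (Function.uncurry b')) (P : Finset I) :
    HasCommonRealization φ b P ↔ HasCommonRealization φ b' P := by
  have hdef : (∅ : Set 𝕆).Definable L
      {a : I × ι → 𝕆 | HasCommonRealization φ (Function.curry a) P} :=
    Set.empty_definable_iff.2
      ⟨commonRealizationFormula φ P, Set.ext fun _ => realize_commonRealizationFormula.symm⟩
  exact h _ (hdef.mono (Set.empty_subset A))

theorem hasCommonRealization_coe {b : I → ι → 𝕆} {P : Finset I} :
    HasCommonRealization φ (fun i : P => b i) Finset.univ ↔ HasCommonRealization φ b P := by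
  simp [HasCommonRealization]

theorem MorleyOver.hasCommonRealization_univ_iff [Finite ι] {U : Ultrafilter (ι → 𝕆)}
    [LinearOrder I] [Fintype I] (hU : InvariantOver L U A) {e : ℕ → ι → 𝕆}
    (he : MorleyOver L U A e) {b : I → ι → 𝕆} (hb : MorleyOver L U A b) :
    HasCommonRealization φ b Finset.univ ↔
      HasCommonRealization φ e (Finset.range (Fintype.card I)) := by
  let f := (Fintype.orderIsoFinOfCardEq I rfl).symm
  let g : I → ℕ := fun i => f i
  have hg : StrictMono g := Fin.val_strictMono.comp f.strictMono
  have himage : Finset.univ.image g = Finset.range (Fintype.card I) := by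
    ext j
    simp only [Finset.mem_image, Finset.mem_univ, true_and, Finset.mem_range]
    exact ⟨fun ⟨i, hi⟩ => hi ▸ (f i).2, fun hj => ⟨f.symm ⟨j, hj⟩, by simp [g]⟩⟩
  rw [(hb.sameType_uncurry hU (he.comp hg)).hasCommonRealization_iff, ← himage,
    hasCommonRealization_image]

theorem IsMorleyTree.isTreePattern {φ : L.Formula (Fin n ⊕ Fin m)} {U V : Ultrafilter (Fin m → 𝕆)}
    {k l : ℕ} {b : List Bool → Fin m → 𝕆} (hb : IsMorleyTree L U V A l b) (hU : InvariantOver L U A)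
    (hV : InvariantOver L V A) {e e' : ℕ → Fin m → 𝕆} (he : MorleyOver L U A e)
    (he' : MorleyOver L V A e') (hφ : ∀ r, HasCommonRealization φ e (Finset.range r))
    (hφ' : ¬ HasCommonRealization φ e' (Finset.range k)) :
    IsTreePattern φ id {σ | σ.length < l} k b where
  antichain P hP hanti := by
    have hPa : IsAntichain (· <+: ·) (P : Set (List Bool)) := fun σ hσ τ hτ hne hpre =>
      hanti hσ hτ hne ⟨hpre, hne⟩
    exact hasCommonRealization_coe.1
      ((he.hasCommonRealization_univ_iff hU (hb.antichain P hP hPa)).2 (hφ _))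
  chain P hP hchain hk hcommon := by
    refine hφ' (HasCommonRealization.mono ((he'.hasCommonRealization_univ_iff hV
      (hb.chain hP hchain)).1 (hasCommonRealization_coe.2 hcommon)) ?_)
    simpa using hk

end KimDividing

theorem hasATP_of_strongBiInvariantKimFailure {L : FirstOrder.Language.{u, v}} {T : L.Theory}
    (hT : ∀ K : Theory.ModelType.{u, v, max u v w} T, Infinite K)
    (h : StrongBiInvariantKimFailure.{u, v, max u v w} T) : HasATP.{u, v, max u v w} T := by
  obtain ⟨𝕆, N, hsat, n, m, φ, d, p, q, hp, hpd, hq, hqd, hqφ, hpφ⟩ := h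
  have hN : (N : Set 𝕆).Infinite := Set.infinite_coe_iff.1 (hT (Theory.ModelType.of T N))
  obtain ⟨U, hU⟩ := p.exists_represents
  obtain ⟨V, hV⟩ := q.exists_represents
  have hVinv := hV.isInvariant_iff.1 hq
  obtain ⟨e, he⟩ := hsat.exists_morleyOver hN Set.finite_empty U
  rw [Set.union_empty] at he
  obtain ⟨e', he', k, hk⟩ := hV.kimDividesAlong_iff.1 hqφ
  refine HasTreePattern.hasATP (φ := φ) (k := k) (hasTreePattern_of_finite fun J => ?_)
  obtain ⟨b, hb⟩ := exists_isMorleyTree hp hU hVinv hsat hN (hU.realizesRestriction_iff.1 hpd)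
    (hV.realizesRestriction_iff.1 hqd) (J.sup List.length + 1)
  have hpattern := hb.isTreePattern (hU.isInvariant_iff.1 hp.1) hVinv he he' (φ := φ)
    (fun r => by_contra fun hr => hpφ (hU.kimDividesAlong_iff.2 ⟨e, he, r, hr⟩)) hk
  exact ⟨𝕆, b, hpattern.comp (g := id) Function.injective_id.injOn fun σ hσ =>
    Nat.lt_succ_of_le (Finset.le_sup hσ.2)⟩

section Saturation

variable {L : FirstOrder.Language.{u, v}} {𝕆 : Type w} [L.Structure 𝕆]

theorem IsSaturated.lt_mk [Nonempty 𝕆] [Infinite 𝕆] {κ : Cardinal.{w}}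
    (h : IsSaturated L (Order.succ κ) 𝕆) : κ < Cardinal.mk 𝕆 := by
  by_contra! hκ
  obtain ⟨a, ha⟩ := h.exists_realizesOver (C := Set.univ) (Filter.hyperfilter (Fin 1 → 𝕆))
    (by rwa [Cardinal.mk_univ, Order.lt_succ_iff])
  have hmem := (ha _ (Set.Definable.singleton_of_mem (L := L) (Set.mem_univ (a 0)))).2 rfl
  refine ((Set.finite_singleton a).subset fun x hx => ?_).notMem_hyperfilter hmem
  ext i
  rwa [Subsingleton.elim i 0]

variable {O : L.ElementarySubstructure 𝕆}

theorem realize_coe_iff {A : Set 𝕆} (hA : A ⊆ O) {ι : Type*} (φ : L.Formula (A ⊕ ι)) (x : ι → O) :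
    φ.Realize (Sum.elim (fun a : A => (⟨a, hA a.2⟩ : O)) x) ↔
      φ.Realize (Sum.elim (↑) fun i => (x i : 𝕆)) := by
  rw [← O.subtype.map_formula φ, Sum.comp_elim]
  rfl

theorem exists_coe_mem_of_definable {A : Set 𝕆} (hA : A ⊆ O) {ι : Type*} [Finite ι]
    {S : Set (ι → 𝕆)} (hS : A.Definable L S) (hne : S.Nonempty) :
    ∃ x : ι → O, (fun i => (x i : 𝕆)) ∈ S := by
  obtain ⟨φ, rfl⟩ := Set.definable_iff_exists_formula_sum.1 hS
  have h : (φ.iExs ι).Realize (O.subtype ∘ fun a : A => (⟨a, hA a.2⟩ : O)) :=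
    Formula.realize_iExs.2 hne
  rw [O.subtype.map_formula, Formula.realize_iExs] at h
  exact h.imp fun x hx => (realize_coe_iff hA φ x).1 hx

theorem definable_preimage_coe {A : Set 𝕆} (hA : A ⊆ O) {ι : Type*} {S : Set (ι → 𝕆)}
    (hS : A.Definable L S) :
    ((↑) ⁻¹' A : Set O).Definable L {x : ι → O | (fun i => (x i : 𝕆)) ∈ S} := by
  obtain ⟨φ, rfl⟩ := Set.definable_iff_exists_formula_sum.1 hS
  let g : A → ((↑) ⁻¹' A : Set O) := fun a => ⟨⟨a, hA a.2⟩, a.2⟩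
  refine Set.definable_iff_exists_formula_sum.2 ⟨φ.relabel (Sum.map g id), Set.ext fun x => ?_⟩
  change φ.Realize (Sum.elim (↑) fun i => (x i : 𝕆)) ↔ (φ.relabel _).Realize _
  rw [← realize_coe_iff hA, Formula.realize_relabel, Sum.elim_comp_map]
  rfl

theorem exists_ultrafilter_mem_iff {α ι : Type*} {C : Set 𝕆} (f : α → ι → 𝕆) {b : ι → 𝕆}
    (h : ∀ S : Set (ι → 𝕆), C.Definable L S → b ∈ S → ∃ x, f x ∈ S) :
    ∃ W : Ultrafilter α, ∀ S : Set (ι → 𝕆), C.Definable L S → (f ⁻¹' S ∈ W ↔ b ∈ S) := by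
  obtain ⟨W, hW⟩ := exists_ultrafilter_realize_mem_iff (L := L[[C]]) f (fun ψ => ψ.Realize b)
    (fun _ => Formula.realize_not) (fun _ _ hψ hχ => Formula.realize_inf.2 ⟨hψ, hχ⟩)
    fun ψ hψ => h _ ⟨ψ, rfl⟩ hψ
  refine ⟨W, ?_⟩
  rintro _ ⟨ψ, rfl⟩
  exact hW ψ

theorem IsSaturated.exists_coe_sameType [Nonempty 𝕆] {κ : Cardinal.{w}}
    (hO : IsSaturated L (Order.succ κ) O) {A : Set 𝕆} (hA : A ⊆ O) (hAκ : Cardinal.mk A ≤ κ)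
    {l : ℕ} (b : Fin l → 𝕆) :
    ∃ b' : Fin l → O, SameType L A (fun i => (b' i : 𝕆)) b := by
  obtain ⟨W, hW⟩ := exists_ultrafilter_mem_iff (L := L) (C := A) (b := b)
    (fun (x : Fin l → O) i => (x i : 𝕆)) fun S hS hb => exists_coe_mem_of_definable hA hS ⟨b, hb⟩
  have hcard : Cardinal.mk ((↑) ⁻¹' A : Set O) < Order.succ κ :=
    Order.lt_succ_iff.2 ((Cardinal.mk_preimage_of_injective _ _ Subtype.val_injective).trans hAκ)
  obtain ⟨b', hb'⟩ := hO.exists_realizesOver W hcard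
  exact ⟨b', fun S hS => (hb' _ (definable_preimage_coe hA hS)).symm.trans (hW S hS)⟩

end Saturation

section RealizingTypes

variable {L : FirstOrder.Language.{u, v}} {𝕆 : Type w} [L.Structure 𝕆] {M N : Set 𝕆}

/-- `Z` realizes all types, in finitely many variables, over the sets `M ∪ c` with `c` a finite
tuple of `Y`. For `Y = Z` this is the relative saturation that makes `M`-invariant types strongly
bi-invariant over `Z`. -/
def RealizesTypesOver (L : FirstOrder.Language.{u, v}) {𝕆 : Type w} [L.Structure 𝕆]
    (M Y Z : Set 𝕆) : Prop :=
  ∀ (k l : ℕ) (c : Fin k → 𝕆) (b : Fin l → 𝕆), Set.range c ⊆ Y →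
    ∃ b' : Fin l → 𝕆, Set.range b' ⊆ Z ∧ SameType L (M ∪ Set.range c) b' b

theorem RealizesTypesOver.mono_right {Y Z Z' : Set 𝕆} (h : RealizesTypesOver L M Y Z)
    (hZ : Z ⊆ Z') : RealizesTypesOver L M Y Z' := by
  intro k l c b hc
  obtain ⟨b', hb', hbb⟩ := h k l c b hc
  exact ⟨b', hb'.trans hZ, hbb⟩

theorem RealizesTypesOver.iUnion {X : ℕ → Set 𝕆} (hX : Monotone X)
    (h : ∀ i, RealizesTypesOver L M (X i) (X (i + 1))) :
    RealizesTypesOver L M (⋃ i, X i) (⋃ i, X i) := by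
  intro k l c b hc
  obtain ⟨i, hi⟩ := hX.directed_le.exists_mem_subset_of_finset_subset_biUnion
    (s := (Set.finite_range c).toFinset) (by simpa using hc)
  obtain ⟨b', hb', hbb⟩ := h i k l c b (by simpa using hi)
  exact ⟨b', hb'.trans (Set.subset_iUnion X _), hbb⟩

theorem RealizesTypesOver.meetsDefinable (h : RealizesTypesOver L M N N) : L.MeetsDefinable N := by
  rintro D ⟨x, hx⟩ hD
  obtain ⟨k, c, S, hc, hS, hDS⟩ := exists_empty_definable_eq_fiber hD
  obtain ⟨b, hb, hbx⟩ := h k 1 c (fun _ => x) hc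
  have hdef := definable_fiber hS (C := M ∪ Set.range c) (Set.empty_subset _) Set.subset_union_right
  rw [← hDS] at hdef
  exact ⟨b 0, (hbx _ hdef).2 hx, hb ⟨0, rfl⟩⟩

theorem RealizesTypesOver.exists_elementarySubstructure (h : RealizesTypesOver L M N N) :
    ∃ E : L.ElementarySubstructure 𝕆, (E : Set 𝕆) = N :=
  ⟨h.meetsDefinable.toElementarySubstructure, h.meetsDefinable.closure_eq_self⟩

theorem invariantOver_map_coe {ι : Type*} (W : Ultrafilter (ι → N)) :
    InvariantOver L (W.map fun x i => (x i : 𝕆)) N := by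
  intro k S hS b b' hb
  have hmem (x : ι → N) : Sum.elim (fun i => (x i : 𝕆)) b ∈ S ↔
      Sum.elim (fun i => (x i : 𝕆)) b' ∈ S := by
    have hdef := definable_fiber (hS.preimage_comp Sum.swap) subset_rfl
      (Set.range_subset_iff.2 fun i => (x i).2)
    simpa only [Set.mem_ofPred_eq, Set.mem_preimage, Sum.elim_swap] using hb _ hdef
  rw [Ultrafilter.mem_map, Ultrafilter.mem_map]
  exact iff_of_eq (congrArg (· ∈ W) (Set.ext hmem))

theorem isStronglyBiInvariant_of_realizesTypesOver [Nonempty 𝕆] (hMN : M ⊆ N)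
    (hN : RealizesTypesOver L M N N) {m : ℕ} {p : GlobalType L 𝕆 m}
    {U : Ultrafilter (Fin m → 𝕆)} (hU : Represents U p) (hinv : InvariantOver L U M) :
    IsStronglyBiInvariant p N := by
  refine ⟨hU.isInvariant_iff.2 (hinv.mono hMN), fun r k a b hab => ?_⟩
  have ha : MorleyOver L U (N ∪ Set.range b) a := hU.realizesPower_iff.1 hab
  have hrange : Set.range (Function.uncurry a) = ⋃ i, Set.range (a i) := by
    ext x
    simp [Set.mem_iUnion]
  rw [← hrange]
  obtain ⟨W, hW⟩ := exists_ultrafilter_mem_iff (L := L)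
    (C := N ∪ Set.range (Function.uncurry a)) (b := b) (fun (x : Fin k → N) i => (x i : 𝕆))
    fun S hS hb => by
      obtain ⟨S', hS', rfl⟩ := exists_definable_eq_fiber hS
      obtain ⟨l, c, S'', hc, hS'', rfl⟩ := exists_empty_definable_eq_fiber hS'
      obtain ⟨b', hb', hbb⟩ := hN l k c b hc
      have hMcN : M ∪ Set.range c ⊆ N := Set.union_subset hMN hc
      have hsame := (MorleyOver.sameType_elim (hinv.mono Set.subset_union_left) hbb
        (ha.mono (Set.union_subset (hMcN.trans Set.subset_union_left)
          (hb'.trans Set.subset_union_left)))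
        (ha.mono (Set.union_subset_union_left _ hMcN))).comp Sum.swap
      rw [Sum.elim_swap, Sum.elim_swap] at hsame
      refine ⟨fun i => ⟨b' i, hb' ⟨i, rfl⟩⟩, (hsame _ ?_).2 hb⟩
      exact definable_fiber hS'' (Set.empty_subset _) Set.subset_union_right
  exact invariantlyIndep_iff.2 ⟨_, invariantOver_map_coe W, fun S hS => hW S hS⟩

end RealizingTypes

section AdjoinTuple

variable {L : FirstOrder.Language.{u, v}} {𝕆 : Type w} [L.Structure 𝕆] {A C : Set 𝕆}
  {ι ι' γ : Type*} {U : Ultrafilter (ι → 𝕆)} {c : γ → 𝕆}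

/-- The type of `y ⌢ c` for `y` realizing `U`. The map `f` numbers the coordinates of the extended
tuple: the types of the statement are indexed by some `Fin m`, which a sum is not. -/
def adjoinTuple (U : Ultrafilter (ι → 𝕆)) (c : γ → 𝕆) (f : ι' → ι ⊕ γ) : Ultrafilter (ι' → 𝕆) :=
  U.map fun y => Sum.elim y c ∘ f

theorem InvariantOver.adjoinTuple (hU : InvariantOver L U A) (hc : Set.range c ⊆ A)
    (f : ι' → ι ⊕ γ) : InvariantOver L (adjoinTuple U c f) A := by
  intro k S hS b b' hb
  let g : ι' ⊕ Fin k → (ι ⊕ Fin k) ⊕ γ :=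
    Sum.elim (Sum.map Sum.inl id ∘ f) (Sum.inl ∘ Sum.inr)
  have hg (b : Fin k → 𝕆) (y : ι → 𝕆) :
      Sum.elim (Sum.elim y b) c ∘ g = Sum.elim (Sum.elim y c ∘ f) b := by
    ext (i | j)
    · rcases h : f i with j | j <;> simp [g, h]
    · rfl
  have h := hU k _ (definable_fiber (hS.preimage_comp g) subset_rfl hc) b b' hb
  simp only [Set.mem_ofPred_eq, Set.mem_preimage, hg] at h
  exact h

theorem RealizesOver.adjoinTuple {a : ι → 𝕆} (ha : RealizesOver L U C a) (hc : Set.range c ⊆ C)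
    (f : ι' → ι ⊕ γ) : RealizesOver L (adjoinTuple U c f) C (Sum.elim a c ∘ f) :=
  fun _ hS => ha _ (definable_fiber (hS.preimage_comp f) subset_rfl hc)

theorem MorleyOver.adjoinTuple {I : Type*} [LT I] {e : I → ι → 𝕆} (he : MorleyOver L U C e)
    (hc : Set.range c ⊆ C) (f : ι' → ι ⊕ γ) :
    MorleyOver L (adjoinTuple U c f) C fun i => Sum.elim (e i) c ∘ f := by
  refine fun i => ((he i).adjoinTuple (hc.trans Set.subset_union_left) f).mono
    (Set.union_subset Set.subset_union_left (Set.iUnion₂_subset fun j hj => ?_))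
  refine (Set.range_comp_subset_range _ _).trans ?_
  rw [Set.Sum.elim_range]
  refine Set.union_subset (Set.subset_union_of_subset_right ?_ _) (hc.trans Set.subset_union_left)
  exact Set.subset_iUnion₂_of_subset j hj subset_rfl

theorem exists_formula_realize_adjoin {α β : Type*} (φ : L[[A]].Formula (α ⊕ β)) :
    ∃ (k : ℕ) (c : Fin k → 𝕆) (ψ : L.Formula (α ⊕ β ⊕ Fin k)), Set.range c ⊆ A ∧
      ∀ x y, φ.Realize (Sum.elim x y) ↔ ψ.Realize (Sum.elim x (Sum.elim y c)) := by
  obtain ⟨k, c, S, hc, hS, hφ⟩ := exists_empty_definable_eq_fiber (L := L) (A := A) ⟨φ, rfl⟩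
  obtain ⟨ψ, rfl⟩ := Set.empty_definable_iff.1 hS
  refine ⟨k, c, ψ.relabel (Equiv.sumAssoc _ _ _), hc, fun x y => ?_⟩
  rw [Formula.realize_relabel]
  have hassoc : Sum.elim x (Sum.elim y c) ∘ Equiv.sumAssoc _ _ _ = Sum.elim (Sum.elim x y) c := by
    ext ((i | i) | i) <;> rfl
  rw [hassoc]
  exact Set.ext_iff.1 hφ _

end AdjoinTuple

section Traces

variable {L : FirstOrder.Language.{u, v}} {𝕆 : Type w} [L.Structure 𝕆] [Nonempty 𝕆] {M C : Set 𝕆}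
  {m : ℕ} {U V : Ultrafilter (Fin m → 𝕆)}

/-- The formulas `φ(y, b)` in the type of `U`, with `φ` over `M`, where `b` is remembered only up to
its type over `M`. For `M`-invariant `U` this loses nothing, and it bounds the number of
`M`-invariant types independently of the ambient model. -/
def traces (L : FirstOrder.Language.{u, v}) {𝕆 : Type w} [L.Structure 𝕆] [Nonempty 𝕆] {m : ℕ}
    (M : Set 𝕆) (U : Ultrafilter (Fin m → 𝕆)) :
    Set (Σ k : ℕ, L[[M]].Formula (Fin m ⊕ Fin k) × TypeOver L M k) :=
  {z | ∃ b, tp M b = z.2.2 ∧ {x | z.2.1.Realize (Sum.elim x b)} ∈ U}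

theorem InvariantOver.mem_traces_iff (hU : InvariantOver L U M) {k : ℕ}
    {φ : L[[M]].Formula (Fin m ⊕ Fin k)} {b : Fin k → 𝕆} :
    ⟨k, φ, tp M b⟩ ∈ traces L M U ↔ {x | φ.Realize (Sum.elim x b)} ∈ U := by
  refine ⟨?_, fun h => ⟨b, rfl, h⟩⟩
  rintro ⟨b', hb, hb'⟩
  exact (hU k _ ⟨φ, rfl⟩ b' b (tp_eq_iff.1 hb)).1 hb'

theorem RealizesOver.of_traces_eq {a : Fin m → 𝕆} (ha : RealizesOver L U C a)
    (hU : InvariantOver L U M) (hV : InvariantOver L V M) (h : traces L M U = traces L M V) :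
    RealizesOver L V C a := by
  intro S hS
  rw [← ha S hS]
  obtain ⟨k, c, S', -, hS', rfl⟩ := exists_empty_definable_eq_fiber hS
  obtain ⟨φ, rfl⟩ := hS'.mono (Set.empty_subset M)
  exact hV.mem_traces_iff.symm.trans ((Set.ext_iff.1 h.symm _).trans hU.mem_traces_iff)

end Traces

section Cardinality

open Cardinal

theorem mk_sigma_le_of_le {ι : Type w} {f : ι → Type w} {κ : Cardinal.{w}} (hκ : ℵ₀ ≤ κ)
    (hι : #ι ≤ κ) (hf : ∀ i, #(f i) ≤ κ) : #(Σ i, f i) ≤ κ :=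
  (mk_sigma f).trans_le ((sum_le_mk_mul_iSup _).trans (mul_le_of_le hκ hι (ciSup_le' hf)))

theorem mk_sigma_nat_le_of_le {f : ℕ → Type w} {κ : Cardinal.{w}} (hκ : ℵ₀ ≤ κ)
    (hf : ∀ i, #(f i) ≤ κ) : #(Σ i, f i) ≤ κ :=
  (mk_sigma f).trans_le ((sum_le_lift_mk_mul_iSup _).trans
    (mul_le_of_le hκ (by simpa using hκ) (ciSup_le' hf)))

theorem mk_iUnion_le_of_le {ι α : Type w} {f : ι → Set α} {κ : Cardinal.{w}} (hκ : ℵ₀ ≤ κ)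
    (hι : #ι ≤ κ) (hf : ∀ i, #(f i) ≤ κ) : #(⋃ i, f i) ≤ κ :=
  (mk_iUnion_le f).trans (mul_le_of_le hκ hι (ciSup_le' hf))

theorem mk_union_le_of_le {α : Type w} {A B : Set α} {κ : Cardinal.{w}} (hκ : ℵ₀ ≤ κ)
    (hA : #A ≤ κ) (hB : #B ≤ κ) : #(A ∪ B : Set α) ≤ κ :=
  (mk_union_le _ _).trans (add_le_of_le hκ hA hB)

theorem mk_le_of_finite {α : Type w} {A : Set α} {κ : Cardinal.{w}} (hκ : ℵ₀ ≤ κ)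
    (hA : A.Finite) : #A ≤ κ :=
  (lt_aleph0_iff_set_finite.2 hA).le.trans hκ

theorem mk_fin_fun_le_of_le {α : Type w} {κ : Cardinal.{w}} (hκ : ℵ₀ ≤ κ) (hα : #α ≤ κ) (k : ℕ) :
    #(Fin k → α) ≤ κ := by
  simpa using (power_le_power_right hα).trans (power_nat_le hκ)

theorem mk_formula_le (L : FirstOrder.Language.{u, v}) (α : Type w) [Finite α] :
    #(L.Formula α) ≤ max ℵ₀ (Cardinal.lift.{w} L.card) := by
  have hinj : #(L.Formula α) ≤ #(Σ n, L.BoundedFormula α n) :=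
    mk_le_of_injective (f := fun φ => ⟨0, φ⟩) fun φ ψ h => by simpa using h
  refine (hinj.trans BoundedFormula.card_le).trans (max_le (le_max_left _ _) ?_)
  exact add_le_of_le (le_max_left _ _)
    ((lift_lt_aleph0.2 (lt_aleph0_of_finite α)).le.trans (le_max_left _ _)) (le_max_right _ _)

variable {L : FirstOrder.Language.{u, v}} {𝕆 : Type max u v w} {A : Set 𝕆}
  {μ : Cardinal.{max u v w}}

theorem mk_formula_withConstants_le (hμ : ℵ₀ ≤ μ) (hL : Cardinal.lift.{max u v w} L.card ≤ μ)
    (hA : #A ≤ μ) (α : Type) [Finite α] : #(L[[A]].Formula α) ≤ μ := by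
  refine (mk_formula_le L[[A]] α).trans (max_le hμ ?_)
  rw [lift_uzero, card_withConstants, lift_id'.{max u v, w}]
  exact add_le_of_le hμ hL hA

theorem mk_typeOver_le [L.Structure 𝕆] (hμ : ℵ₀ ≤ μ)
    (hL : Cardinal.lift.{max u v w} L.card ≤ μ) (hA : #A ≤ μ) (k : ℕ) :
    #(TypeOver L A k) ≤ 2 ^ μ := by
  have hinj : #(TypeOver L A k) ≤ #(Set (L[[A]].Formula (Fin k))) :=
    mk_le_of_injective (f := fun p => {ψ | p.Has ψ}) fun _ _ h =>
      TypeOver.ext_has fun ψ => Set.ext_iff.1 h ψ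
  rw [mk_set] at hinj
  exact hinj.trans
    (power_le_power_left two_ne_zero (mk_formula_withConstants_le hμ hL hA (Fin k)))

end Cardinality

section Clubs

open Cardinal

section Sets

variable {S : Type w} {O Y : Set S} {κ : Cardinal.{w}} {C : Set (Set S)}

theorem IsClubIn.exists_superset_mem (hC : IsClubIn O κ C) (hκ : ℵ₀ ≤ κ) (hκO : κ ≤ #O)
    (hYO : Y ⊆ O) (hY : #Y ≤ κ) : ∃ X ∈ C, Y ⊆ X := by
  obtain ⟨P, hPO, hP⟩ := le_mk_iff_exists_subset.1 hκO
  obtain ⟨X, hX, hYX⟩ := hC.2.1 (Y ∪ P) ⟨Set.union_subset hYO hPO,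
    (mk_union_le_of_le hκ hY hP.le).antisymm
      (hP.symm.le.trans (mk_le_mk_of_subset Set.subset_union_right))⟩
  exact ⟨X, hX, Set.subset_union_left.trans hYX⟩

theorem IsClubIn.exists_monotone_iUnion_mem (hC : IsClubIn O κ C) (hκ : ℵ₀ ≤ κ)
    {R : Set S → Set S → Prop} (hR : ∀ X ∈ C, ∃ Z ∈ C, X ⊆ Z ∧ R X Z) (hY : Y ∈ C) :
    ∃ X : ℕ → Set S, X 0 = Y ∧ Monotone X ∧ (∀ i, R (X i) (X (i + 1))) ∧ ⋃ i, X i ∈ C := by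
  choose! next hnext hsub hrel using hR
  let X : ℕ → Set S := fun i => next^[i] Y
  have hsucc (i : ℕ) : X (i + 1) = next (X i) := Function.iterate_succ_apply' next i Y
  have hXC (i : ℕ) : X i ∈ C := by
    induction i with
    | zero => exact hY
    | succ i ih => exact hsucc i ▸ hnext _ ih
  have hmono : Monotone X := monotone_nat_of_le_succ fun i => hsucc i ▸ hsub _ (hXC i)
  refine ⟨X, rfl, hmono, fun i => hsucc i ▸ hrel _ (hXC i), ?_⟩
  rw [← Set.sUnion_range]
  exact hC.2.2 _ (Set.range_subset_iff.2 hXC) (Set.range_nonempty X) hmono.isChain_range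
    ((Set.countable_range X).le_aleph0.trans hκ)

end Sets

variable {L : FirstOrder.Language.{u, v}}

theorem IsSaturated.exists_finite_realizing {𝕆 : Type w} [L.Structure 𝕆] [Nonempty 𝕆]
    {O : L.ElementarySubstructure 𝕆} {A : Set 𝕆} {κ : Cardinal.{w}}
    (hO : IsSaturated L (Order.succ κ) O) (hA : A ⊆ O) (hAκ : #A ≤ κ) {l : ℕ}
    (t : TypeOver L A l) :
    ∃ W : Set 𝕆, W ⊆ O ∧ W.Finite ∧ ∀ b : Fin l → 𝕆, tp A b = t →
      ∃ b' : Fin l → 𝕆, Set.range b' ⊆ W ∧ SameType L A b' b := by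
  by_cases ht : ∃ b : Fin l → 𝕆, tp A b = t
  · obtain ⟨b, rfl⟩ := ht
    obtain ⟨b', hb'⟩ := hO.exists_coe_sameType hA hAκ b
    exact ⟨Set.range fun i => (b' i : 𝕆), Set.range_subset_iff.2 fun i => (b' i).2,
      Set.finite_range _, fun b₁ hb₁ => ⟨_, subset_rfl, hb'.trans (tp_eq_iff.1 hb₁).symm⟩⟩
  · exact ⟨∅, Set.empty_subset _, Set.finite_empty, fun b hb => absurd ⟨b, hb⟩ ht⟩

variable {𝕆 : Type max u v w} [L.Structure 𝕆] [Nonempty 𝕆]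
  {O : L.ElementarySubstructure 𝕆} {M : Set 𝕆} {κ : Cardinal.{max u v w}}

theorem exists_superset_realizesTypesOver {Y : Set 𝕆} (hκ : ℵ₀ ≤ κ)
    (hO : IsSaturated L (Order.succ κ) O) (hM : M ⊆ O) (hMκ : #M ≤ κ)
    (hcard : ∀ (k l : ℕ) (c : Fin k → 𝕆), #(TypeOver L (M ∪ Set.range c) l) ≤ κ)
    (hY : Y ∈ subsetsOfCard (O : Set 𝕆) κ) :
    ∃ Z ∈ subsetsOfCard (O : Set 𝕆) κ, Y ⊆ Z ∧ RealizesTypesOver L M Y Z := by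
  let A {k : ℕ} (c : Fin k → Y) : Set 𝕆 := M ∪ Set.range fun i => (c i : 𝕆)
  have hAO {k : ℕ} (c : Fin k → Y) : A c ⊆ O :=
    Set.union_subset hM (Set.range_subset_iff.2 fun i => hY.1 (c i).2)
  have hAκ {k : ℕ} (c : Fin k → Y) : #(A c) ≤ κ :=
    mk_union_le_of_le hκ hMκ (mk_le_of_finite hκ (Set.finite_range _))
  let I : Type max u v w := Σ k : ℕ, Σ l : ℕ, Σ c : Fin k → Y, TypeOver L (A c) l
  have hI : #I ≤ κ := mk_sigma_nat_le_of_le hκ fun k => mk_sigma_nat_le_of_le hκ fun l =>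
    mk_sigma_le_of_le hκ (mk_fin_fun_le_of_le hκ hY.2.le k) fun c => hcard k l _
  choose W hWO hWfin hW using fun i : I => hO.exists_finite_realizing (hAO i.2.2.1)
    (hAκ i.2.2.1) i.2.2.2
  refine ⟨Y ∪ ⋃ i, W i, ⟨Set.union_subset hY.1 (Set.iUnion_subset hWO), ?_⟩,
    Set.subset_union_left, fun k l c b hc => ?_⟩
  · exact (mk_union_le_of_le hκ hY.2.le (mk_iUnion_le_of_le hκ hI fun i =>
      mk_le_of_finite hκ (hWfin i))).antisymm
        (hY.2.symm.le.trans (mk_le_mk_of_subset Set.subset_union_left))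
  · let i : I := ⟨k, l, fun j => ⟨c j, hc ⟨j, rfl⟩⟩, tp _ b⟩
    obtain ⟨b', hb', hbb⟩ := hW i b rfl
    exact ⟨b', hb'.trans (Set.subset_union_of_subset_right (Set.subset_iUnion W i) _), hbb⟩

theorem exists_mem_club_realizesTypesOver (hκ : ℵ₀ ≤ κ) (hO : IsSaturated L (Order.succ κ) O)
    (hκO : κ ≤ #O) (hM : M ⊆ O) (hMκ : #M ≤ κ)
    (hcard : ∀ (k l : ℕ) (c : Fin k → 𝕆), #(TypeOver L (M ∪ Set.range c) l) ≤ κ)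
    {A : Set 𝕆} (hA : A ⊆ O) (hAκ : #A ≤ κ) {C : Set (Set 𝕆)} (hC : IsClubIn (O : Set 𝕆) κ C) :
    ∃ X ∈ C, M ⊆ X ∧ A ⊆ X ∧ RealizesTypesOver L M X X := by
  obtain ⟨X₀, hX₀, hMA⟩ := hC.exists_superset_mem hκ hκO (Set.union_subset hM hA)
    (mk_union_le_of_le hκ hMκ hAκ)
  have hstep : ∀ Y ∈ C, ∃ X ∈ C, Y ⊆ X ∧ RealizesTypesOver L M Y X := fun Y hY => by
    obtain ⟨Z, hZ, hYZ, hreal⟩ := exists_superset_realizesTypesOver hκ hO hM hMκ hcard (hC.1 hY)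
    obtain ⟨X, hX, hZX⟩ := hC.2.1 Z hZ
    exact ⟨X, hX, hYZ.trans hZX, hreal.mono_right hZX⟩
  obtain ⟨X, rfl, hmono, hX, hXC⟩ := hC.exists_monotone_iUnion_mem hκ hstep hX₀
  have hMAX := hMA.trans (Set.subset_iUnion X 0)
  exact ⟨_, hXC, Set.subset_union_left.trans hMAX, Set.subset_union_right.trans hMAX,
    .iUnion hmono hX⟩

end Clubs

section MorleyIn

variable {L : FirstOrder.Language.{u, v}} {𝕆 : Type w} [L.Structure 𝕆] {M C : Set 𝕆}

theorem MorleyOver.snoc {ι : Type*} {U : Ultrafilter (ι → 𝕆)} {t : ℕ} {e : Fin t → ι → 𝕆}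
    {d : ι → 𝕆} (he : MorleyOver L U C e) (hd : RealizesOver L U (C ∪ ⋃ i, Set.range (e i)) d) :
    MorleyOver L U C (Fin.snoc e d : Fin (t + 1) → ι → 𝕆) := by
  refine Fin.lastCases ?_ fun i => ?_
  · simp only [Fin.snoc_last]
    refine hd.mono (Set.union_subset_union_right _ (Set.iUnion₂_subset fun j hj => ?_))
    obtain ⟨j, rfl⟩ := Fin.exists_castSucc_eq.2 hj.ne
    simpa only [Fin.snoc_castSucc] using Set.subset_iUnion (fun i => Set.range (e i)) j
  · simp only [Fin.snoc_castSucc]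
    refine (he i).mono (Set.union_subset_union_right _ (Set.iUnion₂_subset fun j hj => ?_))
    obtain ⟨j, rfl⟩ := Fin.exists_castSucc_eq.2 (hj.trans (Fin.castSucc_lt_last i)).ne
    simp only [Fin.snoc_castSucc]
    exact Set.subset_iUnion₂_of_subset j (Fin.castSucc_lt_castSucc_iff.1 hj) subset_rfl

/-- Some Morley sequence over `M` in the type of `U`, of length `t`, consists of tuples in `G`. -/
def HasMorleyIn (L : FirstOrder.Language.{u, v}) {𝕆 : Type w} [L.Structure 𝕆] {ι : Type*}
    (U : Ultrafilter (ι → 𝕆)) (M : Set 𝕆) (G : Set (ι → 𝕆)) (t : ℕ) : Prop :=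
  ∃ e : Fin t → ι → 𝕆, MorleyOver L U M e ∧ ∀ i, e i ∈ G

theorem exists_finite_forall_hasMorleyIn [Nonempty 𝕆] {m : ℕ} (G : Set (Fin m → 𝕆))
    (K : Set (Σ k : ℕ, L[[M]].Formula (Fin m ⊕ Fin k) × TypeOver L M k)) :
    ∃ A ⊆ ⋃ d ∈ G, Set.range d, A.Finite ∧ ∀ U : Ultrafilter (Fin m → 𝕆), InvariantOver L U M →
      traces L M U = K → ∀ d ∈ G, RealizesOver L U (M ∪ A) d → ∀ t, HasMorleyIn L U M G t := by
  classical
  by_cases h : ∃ V, InvariantOver L V M ∧ traces L M V = K ∧ ∃ t, ¬ HasMorleyIn L V M G t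
  · obtain ⟨V, hV, hVK, ht⟩ := h
    have hpos : Nat.find ht ≠ 0 := fun h0 => Nat.find_spec ht (h0 ▸ ⟨Fin.elim0, nofun, nofun⟩)
    obtain ⟨t, hmin⟩ := Nat.exists_eq_succ_of_ne_zero hpos
    -- `e` is a longest such sequence: no suitable element of `G` can continue it.
    obtain ⟨e, he, heG⟩ := not_not.1 (Nat.find_min ht (hmin ▸ t.lt_succ_self))
    refine ⟨⋃ i, Set.range (e i), Set.iUnion_subset fun i =>
      Set.subset_iUnion₂_of_subset (e i) (heG i) subset_rfl,
      Set.finite_iUnion fun i => Set.finite_range _, fun U hU hUK d hdG hd => ?_⟩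
    refine absurd ?_ (Nat.find_spec ht)
    rw [hmin]
    refine ⟨Fin.snoc e d, he.snoc (hd.of_traces_eq hU hV (hUK.trans hVK.symm)), ?_⟩
    exact Fin.lastCases (by simpa using hdG) fun i => by simpa using heG i
  · push Not at h
    exact ⟨∅, Set.empty_subset _, Set.finite_empty, fun U hU hK _ _ _ t => h U hU hK t⟩

end MorleyIn

section Instances

variable {L : FirstOrder.Language.{u, v}} {𝕆 : Type w} [L.Structure 𝕆] {M N O : Set 𝕆} {n m : ℕ}
  {P : Ultrafilter (Fin n → 𝕆)}

/-- The parameters `d` in `O` of the instances `φ(x, d)` belonging to the type of `P`. -/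
def instances {ι : Type*} (O : Set 𝕆) (P : Ultrafilter (Fin n → 𝕆)) (φ : L.Formula (Fin n ⊕ ι)) :
    Set (ι → 𝕆) :=
  {d | Set.range d ⊆ O ∧ {x | φ.Realize (Sum.elim x d)} ∈ P}

theorem hasCommonRealization_of_mem_instances {ι I : Type*} {φ : L.Formula (Fin n ⊕ ι)}
    {e : I → ι → 𝕆} (he : ∀ i, e i ∈ instances O P φ) (s : Finset I) :
    HasCommonRealization φ e s := by
  obtain ⟨x, hx⟩ := P.nonempty_of_mem ((Filter.biInter_finset_mem s).2 fun i _ => (he i).2)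
  exact ⟨x, fun i hi => Set.mem_iInter₂.1 hx i hi⟩

theorem not_kimDividesAlong_of_hasMorleyIn_instances {φ : L.Formula (Fin n ⊕ Fin m)}
    {U : Ultrafilter (Fin m → 𝕆)} {p : GlobalType L 𝕆 m} (hU : Represents U p)
    (hinv : InvariantOver L U M) (hMN : M ⊆ N)
    (h : ∀ t, HasMorleyIn L U M (instances O P φ) t) :
    ¬ KimDividesAlong N ((L.lhomWithConstants N).onFormula φ) p := by
  rw [hU.kimDividesAlong_iff]
  rintro ⟨e, he, k, hk⟩
  obtain ⟨c, hc, hcP⟩ := h k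
  refine hk ?_
  rw [← Fintype.card_fin k, ← (he.mono hMN).hasCommonRealization_univ_iff hinv hc]
  exact hasCommonRealization_of_mem_instances hcP _

theorem exists_of_not_xi [Nonempty 𝕆] (hMO : M ⊆ O) (hMN : M ⊆ N) {p : TypeOver L O n}
    (hP : Represents P p) (h : ¬ Xi hMO hMN p) :
    ∃ (m : ℕ) (φ : L.Formula (Fin n ⊕ Fin m)) (d : Fin m → 𝕆) (U V : Ultrafilter (Fin m → 𝕆)),
      d ∈ instances O P φ ∧ InvariantOver L U M ∧ RealizesOver L U N d ∧
      InvariantOver L V N ∧ RealizesOver L V N d ∧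
      ∃ e : ℕ → Fin m → 𝕆, MorleyOver L V N e ∧
        ∃ k, ¬ HasCommonRealization φ e (Finset.range k) := by
  unfold Xi KimDivides at h
  push Not at h
  obtain ⟨m, φ, d, hφ, hd, q, hq, hqd, e, he, hφe⟩ := h
  obtain ⟨U, hU, hUd⟩ := invariantlyIndep_iff.1 hd
  obtain ⟨V, hV⟩ := q.exists_represents
  obtain ⟨k, c, ψ, hc, hψ⟩ := exists_formula_realize_adjoin φ
  let f : Fin (m + k) → Fin m ⊕ Fin k := finSumFinEquiv.symm
  let χ : L.Formula (Fin n ⊕ Fin (m + k)) := ψ.relabel (Sum.map id finSumFinEquiv)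
  have hχ (x : Fin n → 𝕆) (y : Fin m → 𝕆) :
      χ.Realize (Sum.elim x (Sum.elim y c ∘ f)) ↔ φ.Realize (Sum.elim x y) := by
    rw [hψ, Formula.realize_relabel, Sum.elim_comp_map, Function.comp_id, Function.comp_assoc,
      finSumFinEquiv.symm_comp_self, Function.comp_id]
  have hcN := hc.trans hMN
  refine ⟨m + k, χ, Sum.elim (fun j => (d j : 𝕆)) c ∘ f, adjoinTuple U c f, adjoinTuple V c f,
    ⟨?_, ?_⟩, hU.adjoinTuple hc f, hUd.adjoinTuple hcN f,
    (hV.isInvariant_iff.1 hq).adjoinTuple hcN f,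
    (hV.realizesRestriction_iff.1 hqd).adjoinTuple hcN f, fun i => Sum.elim (e i) c ∘ f,
    (hV.isMorleySequence_iff.1 he).adjoinTuple hcN f, ?_⟩
  · refine (Set.range_comp_subset_range _ _).trans ?_
    rw [Set.Sum.elim_range]
    exact Set.union_subset (Set.range_subset_iff.2 fun j => (d j).2) (hc.trans hMO)
  · simpa only [hP _, realize_plug, realize_lift, hχ] using hφ
  · by_contra! hcon
    refine hφe fun s _ => ?_
    obtain ⟨r, hr⟩ := s.exists_nat_subset_range
    obtain ⟨x, hx⟩ := hcon r
    exact ⟨x, fun i hi => (realize_lift hMN φ _).2 ((hχ x (e i)).1 (hx i (hr hi)))⟩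

end Instances

section StationaryLocalCharacter

open Cardinal

variable {L : FirstOrder.Language.{u, v}}

section Bounding

variable {𝕆 : Type max u v w} [L.Structure 𝕆] {μ : Cardinal.{max u v w}} {M : Set 𝕆}

theorem mk_set_traces_le (hμ : ℵ₀ ≤ μ) (hL : Cardinal.lift.{max u v w} L.card ≤ μ) (hM : #M ≤ μ)
    (m : ℕ) : #(Set (Σ k : ℕ, L[[M]].Formula (Fin m ⊕ Fin k) × TypeOver L M k)) ≤
      2 ^ (2 ^ μ : Cardinal.{max u v w}) := by
  have hμ' : ℵ₀ ≤ (2 : Cardinal.{max u v w}) ^ μ := hμ.trans (cantor μ).le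
  rw [mk_set]
  refine power_le_power_left two_ne_zero (mk_sigma_nat_le_of_le hμ' fun k => ?_)
  rw [mk_prod, lift_id, lift_id]
  exact mul_le_of_le hμ' ((mk_formula_withConstants_le hμ hL hM _).trans (cantor μ).le)
    (mk_typeOver_le hμ hL hM k)

variable [Nonempty 𝕆]

theorem exists_forall_hasMorleyIn (hμ : ℵ₀ ≤ μ) (hL : Cardinal.lift.{max u v w} L.card ≤ μ)
    (hM : #M ≤ μ) {m : ℕ} (G : Set (Fin m → 𝕆)) :
    ∃ A ⊆ ⋃ d ∈ G, Set.range d, #A ≤ 2 ^ (2 ^ μ : Cardinal.{max u v w}) ∧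
      ∀ U : Ultrafilter (Fin m → 𝕆), InvariantOver L U M → ∀ d ∈ G, RealizesOver L U (M ∪ A) d →
        ∀ t, HasMorleyIn L U M G t := by
  have hκ : ℵ₀ ≤ (2 : Cardinal.{max u v w}) ^ (2 ^ μ : Cardinal.{max u v w}) :=
    hμ.trans ((cantor μ).le.trans (cantor _).le)
  choose A hAG hAfin hA using exists_finite_forall_hasMorleyIn (L := L) (M := M) G
  refine ⟨⋃ K, A K, Set.iUnion_subset hAG, mk_iUnion_le_of_le hκ (mk_set_traces_le hμ hL hM m)
    fun K => mk_le_of_finite hκ (hAfin K), fun U hU d hdG hd => hA _ U hU rfl d hdG (hd.mono ?_)⟩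
  exact Set.union_subset_union_right _ (Set.subset_iUnion A _)

theorem exists_forall_hasMorleyIn_instances (hμ : ℵ₀ ≤ μ)
    (hL : Cardinal.lift.{max u v w} L.card ≤ μ) (hM : #M ≤ μ) {n : ℕ} (O : Set 𝕆)
    (P : Ultrafilter (Fin n → 𝕆)) :
    ∃ A ⊆ O, #A ≤ 2 ^ (2 ^ μ : Cardinal.{max u v w}) ∧
      ∀ (m : ℕ) (φ : L.Formula (Fin n ⊕ Fin m)) (U : Ultrafilter (Fin m → 𝕆)),
        InvariantOver L U M → ∀ d ∈ instances O P φ, RealizesOver L U (M ∪ A) d →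
          ∀ t, HasMorleyIn L U M (instances O P φ) t := by
  have hκ : ℵ₀ ≤ (2 : Cardinal.{max u v w}) ^ (2 ^ μ : Cardinal.{max u v w}) :=
    hμ.trans ((cantor μ).le.trans (cantor _).le)
  choose A hAG hAκ hA using fun i : Σ m : ℕ, ULift.{w} (L.Formula (Fin n ⊕ Fin m)) =>
    exists_forall_hasMorleyIn (L := L) hμ hL hM (instances O P i.2.down)
  refine ⟨⋃ i, A i, Set.iUnion_subset fun i => (hAG i).trans
    (Set.iUnion₂_subset fun d hd => hd.1), mk_iUnion_le_of_le hκ ?_ hAκ,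
    fun m φ U hU d hdG hd => hA ⟨m, ⟨φ⟩⟩ U hU d hdG (hd.mono ?_)⟩
  · refine mk_sigma_nat_le_of_le hκ fun m => ?_
    have h := lift_le.{w}.2 (mk_formula_le L (Fin n ⊕ Fin m))
    rw [lift_max, lift_aleph0] at h
    rw [lift_umax.{max u v, w}] at hL
    exact (mk_uLift _).trans_le (h.trans (max_le hκ (by
      simpa using hL.trans ((cantor μ).le.trans (cantor _).le))))
  · exact Set.union_subset_union_right _ (Set.subset_iUnion A ⟨m, ⟨φ⟩⟩)

end Bounding

variable {T : L.Theory}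

theorem strongBiInvariantKimFailure_of_not_xi {𝕆 : Theory.ModelType.{u, v, w} T} {M O : Set 𝕆}
    {N : L.ElementarySubstructure 𝕆} (hsat : IsSaturated L (Order.succ #N) 𝕆)
    (hMO : M ⊆ O) (hMN : M ⊆ N) (hN : RealizesTypesOver L M (N : Set 𝕆) N) {n : ℕ}
    {p : TypeOver L O n} {P : Ultrafilter (Fin n → 𝕆)} (hP : Represents P p)
    (hgood : ∀ (m : ℕ) (φ : L.Formula (Fin n ⊕ Fin m)) (U : Ultrafilter (Fin m → 𝕆)),
      InvariantOver L U M → ∀ d ∈ instances O P φ, RealizesOver L U N d →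
        ∀ t, HasMorleyIn L U M (instances O P φ) t) (h : ¬ Xi hMO hMN p) :
    StrongBiInvariantKimFailure.{u, v, w} T := by
  obtain ⟨m, φ, d, U, V, hd, hU, hUd, hV, hVd, hdiv⟩ := exists_of_not_xi hMO hMN hP h
  have hUr := represents_ofUltrafilter (L := L) Set.univ U
  have hVr := represents_ofUltrafilter (L := L) Set.univ V
  exact ⟨𝕆, N, hsat, n, m, φ, d, _, _, isStronglyBiInvariant_of_realizesTypesOver hMN hN hUr hU,
    hUr.realizesRestriction_iff.2 hUd, hVr.isInvariant_iff.2 hV,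
    hVr.realizesRestriction_iff.2 hVd, hVr.kimDividesAlong_iff.2 hdiv,
    not_kimDividesAlong_of_hasMorleyIn_instances hUr hU hMN (hgood m φ U hU d hd hUd)⟩

theorem strongBiInvariantKimFailure_of_not_genericStationaryLocalCharacter
    (hT : ∀ K : Theory.ModelType.{u, v, max u v w} T, Infinite K)
    (h : ¬ GenericStationaryLocalCharacter.{u, v, max u v w} T) :
    StrongBiInvariantKimFailure.{u, v, max u v w} T := by
  unfold GenericStationaryLocalCharacter IsStationaryIn at h
  push Not at h
  obtain ⟨lam, h⟩ := h
  let μ : Cardinal.{max u v w} := max (max lam ℵ₀) (Cardinal.lift.{max u v w} L.card)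
  have hlam : lam ≤ μ := (le_max_left _ _).trans (le_max_left _ _)
  have hμ : ℵ₀ ≤ μ := (le_max_right _ _).trans (le_max_left _ _)
  have hL : Cardinal.lift.{max u v w} L.card ≤ μ := le_max_right _ _
  let κ : Cardinal.{max u v w} := 2 ^ (2 ^ μ : Cardinal.{max u v w})
  have hpow : 2 ^ μ ≤ κ := (cantor _).le
  have hμκ : μ ≤ κ := (cantor μ).le.trans hpow
  obtain ⟨𝕆, O, hsat, hO, n, p, M, hMO, hMlam, C, hC, hempty⟩ := h κ
  have hMμ : #M ≤ μ := hMlam.trans hlam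
  have : Infinite O := hT (Theory.ModelType.of T O)
  have hκO := hO.lt_mk.le
  obtain ⟨P, hP⟩ := p.exists_represents
  obtain ⟨A, hAO, hAκ, hA⟩ := exists_forall_hasMorleyIn_instances.{u, v, w} hμ hL hMμ O P
  have hcard (k l : ℕ) (c : Fin k → 𝕆) : #(TypeOver L (M ∪ Set.range c : Set 𝕆) l) ≤ κ :=
    (mk_typeOver_le.{u, v, w} hμ hL
      (mk_union_le_of_le hμ hMμ (mk_le_of_finite hμ (Set.finite_range c))) l).trans hpow
  obtain ⟨X, hXC, hMX, hAX, hreal⟩ := exists_mem_club_realizesTypesOver.{u, v, w} (hμ.trans hμκ)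
    hO hκO hMO (hMμ.trans hμκ) hcard hAO hAκ hC
  obtain ⟨N, rfl⟩ := hreal.exists_elementarySubstructure
  have hNκ : #N = κ := (hC.1 hXC).2
  refine strongBiInvariantKimFailure_of_not_xi
    (hsat.mono (Order.succ_le_succ (hNκ.le.trans hκO))) hMO hMX hreal hP
    (fun m φ U hU d hd hUd => hA m φ U hU d hd (hUd.mono (Set.union_subset hMX hAX)))
    fun hXi => ?_
  exact Set.eq_empty_iff_forall_notMem.1 hempty N ⟨⟨N, hMX, rfl, (hC.1 hXC).1, hNκ.le, hXi⟩, hXC⟩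

end StationaryLocalCharacter

end LocalCharacter

theorem mainTheorem8 {L : FirstOrder.Language.{u, v}} (T : L.Theory)
    (hT : ∀ K : FirstOrder.Language.Theory.ModelType.{u, v, max u v w} T, Infinite K) :
    (LocalCharacter.IsNATP.{u, v, max u v w} T →
      LocalCharacter.GenericStationaryLocalCharacter.{u, v, max u v w} T) ∧
    (¬ LocalCharacter.GenericStationaryLocalCharacter.{u, v, max u v w} T →
      LocalCharacter.StrongBiInvariantKimFailure.{u, v, max u v w} T) := by
  have kimFailure :=
    LocalCharacter.strongBiInvariantKimFailure_of_not_genericStationaryLocalCharacter hT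
  refine ⟨fun hNATP => ?_, kimFailure⟩
  by_contra hn
  exact hNATP (LocalCharacter.hasATP_of_strongBiInvariantKimFailure hT (kimFailure hn))
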